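/- Let $x\colon[0,\infty)\to\mathbb R$ be càdlàg with finite total variation on every compact interval, let $g\colon\mathbb R\to\mathbb R$ be Borel measurable and locally bounded, and let $f\colon\mathbb R\to\mathbb R$ be a primitive of $g$: for some $f_0\in\mathbb R$, $f(y)=f_0+\int_{[0,y]}g(z)\,dz$ if $y\ge 0$ and $f(y)=f_0-\int_{[y,0]}g(z)\,dz$ if $y<0$. Equivalently (up to changing $g$ on a Lebesgue null set), let $f$ be locally Lipschitz, and let $g$ be Borel measurable and locally integrable with $f(y)=f(0)+\int_0^y g(z)\,dz=f(0)+\int_0^y f'(z)\,dz$ for all $y\in\mathbb R$. Notation. For a function $w\colon[0,\infty)\to\mathbb R$, $t\ge 0$, $z\in\mathbb R$ and $c>0$ put $\sigma_0=0$, $\tau_n=\inf\{u\in[\sigma_n,t]: w_u\ge z+c/2\}$, $\sigma_{n+1}=\inf\{u\in[\tau_n,t]: w_u<z-c/2\}$ (with $\inf\emptyset=+\infty$ and $[+\infty,t]=\emptyset$), and $D^{z,c}(w)=\max\{n:\sigma_n\le t\}$. Let $D^z=\lim_{c\to0+}D^{z,c}(x)$ and $U^z=\lim_{c\to0+}D^{-z,c}(-x)$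 be the numbers of downcrossings and upcrossings of the level $z$ by $x$ on $[0,t]$. Let $\ell^z(t)=\operatorname{Card}(\mathcal I(z)\cap(0,t])-\operatorname{Card}(\mathcal D(z)\cap(0,t])$, where $r\in\mathcal I(z)$ (respectively $r\in\mathcal D(z)$) iff $r>0$, $x$ is continuous at $r$, $x_r=z$, and the sign of $x_r-x_s$ is the sign of $r-s$ (respectively of $s-r$) for all $s$ in some neighbourhood of $r$. Let $\Delta x_s=x_s-x_{s-}$. Then, for every $t\ge 0$, the numbers $U^z$, $D^z$, $\operatorname{Card}(\mathcal I(z)\cap(0,t])$ and $\operatorname{Card}(\mathcal D(z)\cap(0,t])$ are finite for almost every $z$, the two integrals below converge absolutely, the sum below converges unconditionally, and $$f(x_t)-f(x_0)=\int_{\mathbb R}\{U^z-D^z\}\,g(z)\,dz=\int_{\mathbb R}\ell^z(t)\,g(z)\,dz+\sum_{0<s\le t,\ \Delta x_s\ne0}\{f(x_s)-f(x_{s-})\}.$$ The assumption that $g$ is locally bounded cannot be weakened to local integrability: there are a càdlàg $x$ with locally finite total variation, a Borel measurable locally integrable $g$ with primitive $f$, and a $t$, such that the sum over the jumps of $x$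 in $(0,t]$ above does not converge (unconditionally). -/

import Mathlib

open MeasureTheory Filter Topology Set
open scoped NNReal ENNReal

namespace LevelCrossing

/-- `x : [0,∞) → ℝ` is càdlàg: right-continuous at each `t ≥ 0`, with a (finite) left limit at each
`t > 0`. -/
def IsCadlag (x : ℝ≥0 → ℝ) : Prop :=
  (∀ t, ContinuousWithinAt x (Ici t) t) ∧
    ∀ t, 0 < t → ∃ l : ℝ, Tendsto x (𝓝[<] t) (𝓝 l)

/-- The class `V`: càdlàg functions with finite total variation on every compact interval. -/
def IsCadlagLFV (x : ℝ≥0 → ℝ) : Prop :=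
  IsCadlag x ∧ LocallyBoundedVariationOn x univ

/-- The jump `Δx_s = x_s - x_{s-}`. -/
noncomputable def jump (x : ℝ≥0 → ℝ) (s : ℝ≥0) : ℝ := x s - Function.leftLim x s

/-- The jump times of `x` in `(0, t]`. -/
def jumpTimes (x : ℝ≥0 → ℝ) (t : ℝ≥0) : Set ℝ≥0 := {s | 0 < s ∧ s ≤ t ∧ jump x s ≠ 0}

/-- `inf {u ∈ [a, t] : x(u) ∈ A}`, with `inf ∅ = +∞` and `[+∞, t] = ∅`. -/
noncomputable def hitTime (x : ℝ≥0 → ℝ) (t : ℝ≥0) (A : Set ℝ) (a : ℝ≥0∞) : ℝ≥0∞ :=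
  sInf ((fun u : ℝ≥0 => (u : ℝ≥0∞)) '' {u : ℝ≥0 | a ≤ u ∧ u ≤ t ∧ x u ∈ A})

/-- The times `σ_n`: `σ_0 = s`, and from `σ_n` one first waits for `x ≥ y + c/2` (this is the time
`τ_n`) and then for `x < y - c/2` (this is `σ_{n+1}`). -/
noncomputable def sigma (x : ℝ≥0 → ℝ) (s t : ℝ≥0) (y c : ℝ) : ℕ → ℝ≥0∞
  | 0 => s
  | n + 1 => hitTime x t (Iio (y - c / 2)) (hitTime x t (Ici (y + c / 2)) (sigma x s t y c n))

/-- The number `max {n : σ_n ≤ t}` of downcrossings of `[y - c/2, y + c/2]` on `[s, t]`, as a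
supremum in `ℕ ∪ {∞}`. -/
noncomputable def downInterval (x : ℝ≥0 → ℝ) (s t : ℝ≥0) (y c : ℝ) : ℕ∞ :=
  sSup ((fun n : ℕ => (n : ℕ∞)) '' {n : ℕ | sigma x s t y c n ≤ t})

/-- The number of upcrossings of `[y - c/2, y + c/2]` by `x`: downcrossings of
`[-y - c/2, -y + c/2]` by `-x`. -/
noncomputable def upInterval (x : ℝ≥0 → ℝ) (s t : ℝ≥0) (y c : ℝ) : ℕ∞ :=
  downInterval (fun u => -x u) s t (-y) c

/-- The number of times `x` downcrosses the level `y` on `[s, t]`: the limit of the interval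
downcrossing numbers as `c → 0+`. -/
noncomputable def down (x : ℝ≥0 → ℝ) (s t : ℝ≥0) (y : ℝ) : ℕ∞ :=
  limUnder (𝓝[>] (0 : ℝ)) (downInterval x s t y)

/-- The number of times `x` upcrosses the level `y` on `[s, t]`. -/
noncomputable def up (x : ℝ≥0 → ℝ) (s t : ℝ≥0) (y : ℝ) : ℕ∞ :=
  limUnder (𝓝[>] (0 : ℝ)) (upInterval x s t y)

theorem hitTime_mono {x : ℝ≥0 → ℝ} {t : ℝ≥0} {A B : Set ℝ} {a b : ℝ≥0∞} (hAB : B ⊆ A)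
    (hab : a ≤ b) : hitTime x t A a ≤ hitTime x t B b :=
  sInf_le_sInf (image_mono fun _ hu => ⟨hab.trans hu.1, hu.2.1, hAB hu.2.2⟩)

theorem sigma_mono (x : ℝ≥0 → ℝ) (s t : ℝ≥0) (y : ℝ) {c d : ℝ} (h : c ≤ d) (n : ℕ) :
    sigma x s t y c n ≤ sigma x s t y d n := by
  induction n with
  | zero => exact le_rfl
  | succ n ih =>
    exact hitTime_mono (Iio_subset_Iio (by linarith))
      (hitTime_mono (Ici_subset_Ici.2 (by linarith)) ih)

theorem downInterval_antitone (x : ℝ≥0 → ℝ) (s t : ℝ≥0) (y : ℝ) :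
    Antitone (downInterval x s t y) := fun _ _ h =>
  sSup_le_sSup (image_mono fun n hn => (sigma_mono x s t y h n).trans hn)

/-- The limit defining `down` exists and is the supremum over `c > 0`. -/
theorem tendsto_downInterval (x : ℝ≥0 → ℝ) (s t : ℝ≥0) (y : ℝ) :
    Tendsto (downInterval x s t y) (𝓝[>] (0 : ℝ)) (𝓝 (down x s t y)) ∧
      down x s t y = sSup (downInterval x s t y '' Ioi 0) := by
  have h := (downInterval_antitone x s t y).tendsto_nhdsGT 0
  exact ⟨tendsto_nhds_limUnder ⟨_, h⟩, h.limUnder_eq⟩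

/-- The limit defining `up` exists and is the supremum over `c > 0`. -/
theorem tendsto_upInterval (x : ℝ≥0 → ℝ) (s t : ℝ≥0) (y : ℝ) :
    Tendsto (upInterval x s t y) (𝓝[>] (0 : ℝ)) (𝓝 (up x s t y)) ∧
      up x s t y = sSup (upInterval x s t y '' Ioi 0) := by
  have h := (downInterval_antitone (fun u => -x u) s t (-y)).tendsto_nhdsGT 0
  exact ⟨tendsto_nhds_limUnder ⟨_, h⟩, h.limUnder_eq⟩

/-- The times in `(0, t]` at which `x` increases continuously through the level `z`:
`x` is continuous at `r`, `x r = z`, and the sign of `x r - x s` is the sign of `r - s` for all `s`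
in some neighbourhood of `r`. -/
def incTimes (x : ℝ≥0 → ℝ) (z : ℝ) (t : ℝ≥0) : Set ℝ≥0 :=
  {r | 0 < r ∧ r ≤ t ∧ ContinuousAt x r ∧ x r = z ∧
    ∀ᶠ s in 𝓝 r, SignType.sign (x r - x s) = SignType.sign ((r : ℝ) - (s : ℝ))}

/-- The times in `(0, t]` at which `x` decreases continuously through the level `z`. -/
def decTimes (x : ℝ≥0 → ℝ) (z : ℝ) (t : ℝ≥0) : Set ℝ≥0 :=
  {r | 0 < r ∧ r ≤ t ∧ ContinuousAt x r ∧ x r = z ∧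
    ∀ᶠ s in 𝓝 r, SignType.sign (x r - x s) = SignType.sign ((s : ℝ) - (r : ℝ))}

/-- The local time `ℓ^z(t)`: the number of times in `(0, t]` at which `x` increases continuously
through `z` minus the number of those at which it decreases continuously through `z`
(meaningful when both numbers are finite). -/
noncomputable def localTime (x : ℝ≥0 → ℝ) (t : ℝ≥0) (z : ℝ) : ℝ :=
  ((incTimes x z t).ncard : ℝ) - ((decTimes x z t).ncard : ℝ)

/-- The net number `U^z - D^z` of crossings of the level `z` on `[0, t]`
(meaningful when both numbers are finite). -/
noncomputable def netCrossings (x : ℝ≥0 → ℝ) (t : ℝ≥0) (z : ℝ) : ℝ :=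
  ((up x 0 t z).toNat : ℝ) - ((down x 0 t z).toNat : ℝ)

/-- `g` is bounded on bounded sets. -/
def IsLocallyBounded (g : ℝ → ℝ) : Prop := ∀ R : ℝ, ∃ C : ℝ, ∀ z, |z| ≤ R → |g z| ≤ C

/-- `f(y) = f₀ + ∫_{[0,y]} g` for `y ≥ 0` and `f(y) = f₀ - ∫_{[y,0]} g` for `y < 0`, for some
constant `f₀`. -/
def IsPrimitive (f g : ℝ → ℝ) : Prop := ∃ f₀ : ℝ, ∀ y, f y = f₀ + ∫ z in (0 : ℝ)..y, g z

/-- First form of the hypothesis: `g` is Borel and locally bounded, and `f` is a primitive of it. -/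
def BoundedForm (f g : ℝ → ℝ) : Prop := Measurable g ∧ IsLocallyBounded g ∧ IsPrimitive f g

/-- Second form of the hypothesis: `f` is locally Lipschitz, `g` is Borel and locally integrable,
and `f(y) - f(0)` is the integral from `0` to `y` both of `g` and of the derivative of `f`. -/
def LipschitzForm (f g : ℝ → ℝ) : Prop :=
  LocallyLipschitz f ∧ Measurable g ∧ LocallyIntegrable g volume ∧
    (∀ y, f y = f 0 + ∫ z in (0 : ℝ)..y, g z) ∧
    ∀ y, f y = f 0 + ∫ z in (0 : ℝ)..y, deriv f z

end LevelCrossing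

/-!
Call a level `z` regular for `x` if every time at which `x` or its left limit equals `z` is a time of
continuous, strict passage through `z`. The formula is proved level by level for regular `z` and then
integrated against `g`.

*Almost every level is regular* (`ae_isRegularLevel`). Write `x = h ∘ v` with `v` the variation function
of `x` and `h` Lipschitz. By Rademacher's theorem and the one-dimensional Sard theorem, for almost every
`z` the derivative of `h` exists and is nonzero at all points where `h = z`. Outside a countable set of
levels, `x` or its left limit meets `z` only where `v` is continuous and strictly increasing, and there
`x` inherits the strict sign change of `h`. Thus neither the Banach indicatrix nor any measurability in
`z` of the crossing numbers is needed.

*Regular levels.* Passages through a regular level are isolated, hence finitely many on `[0, t]`. The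
indicator of being above `z` just after time `s`, minus the net number of passages in `(0, s]`, is locally
constant in `s`, hence constant as `ℝ≥0` is connected (`IsRegularLevel.balance_eq`). So the net number of
passages, continuous ones and jumps together, is `1_{z < x t} - 1_{z < x 0}`. Each downcrossing needs a
passage of its own, so the crossing numbers are finite. Upcrossings and downcrossings alternate, so their
difference is `1_{z < x t} - 1_{z < x 0}` too (`netCrossings_eq`). Comparing,
`U^z - D^z = ℓ^z + ∑ (signed indicators of the jump gaps at z)`.

*Integration* (`change_of_variable`). The signed indicator of the interval between `a` and `b`, integrated
against `g`, gives `f b - f a`. The jump sum is integrated term by term, as `∑ |Δx|` converges and `g` is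
bounded on the range of `x`; integrability of `ℓ^z g` follows by difference.

For `g` only locally integrable, `f y = 2 √y` and a path with pulses of height `1 / (n + 1)²` give a
divergent jump sum (`exists_not_summable`).
-/

namespace LevelCrossing


/-! ### Crossing numbers as lengths of alternating chains -/

/-- `HasDownChain x z n b`: up to time `b` the path `x` performs `n` successive downcrossings of the
level `z`, i.e. there are times `u₁ ≤ v₁ ≤ ⋯ ≤ uₙ ≤ vₙ ≤ b` with `x uᵢ > z > x vᵢ`. Upcrossings of `z` by
`x` are downcrossings of `-z` by `-x`. -/
def HasDownChain (x : ℝ≥0 → ℝ) (z : ℝ) : ℕ → ℝ≥0 → Prop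
  | 0, _ => True
  | n + 1, b => ∃ u v, HasDownChain x z n u ∧ u ≤ v ∧ v ≤ b ∧ z < x u ∧ x v < z

theorem HasDownChain.mono {x : ℝ≥0 → ℝ} {z : ℝ} {n : ℕ} {b b' : ℝ≥0} (h : HasDownChain x z n b)
    (hb : b ≤ b') : HasDownChain x z n b' := by
  cases n with
  | zero => trivial
  | succ n =>
    obtain ⟨u, v, h, huv, hvb, hu, hv⟩ := h
    exact ⟨u, v, h, huv, hvb.trans hb, hu, hv⟩

/-- Between a start below `z`, the downcrossings, and an end above `z` there is room for one more
upcrossing than there are downcrossings. -/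
theorem HasDownChain.up_succ {x : ℝ≥0 → ℝ} {z : ℝ} (h0 : x 0 < z) {n : ℕ} {b : ℝ≥0}
    (h : HasDownChain x z n b) (hb : z < x b) :
    HasDownChain (fun u => -x u) (-z) (n + 1) b := by
  induction n generalizing b with
  | zero => exact ⟨0, b, trivial, zero_le, le_rfl, neg_lt_neg h0, neg_lt_neg hb⟩
  | succ n ih =>
    obtain ⟨u, v, h, huv, hvb, hu, hv⟩ := h
    exact ⟨v, b, (ih h hu).mono huv, hvb, le_rfl, neg_lt_neg hv, neg_lt_neg hb⟩

/-- Between two successive upcrossings there is a downcrossing. -/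
theorem HasDownChain.of_up_succ {x : ℝ≥0 → ℝ} {z : ℝ} {n : ℕ} {b : ℝ≥0}
    (h : HasDownChain (fun u => -x u) (-z) (n + 1) b) : HasDownChain x z n b := by
  induction n generalizing b with
  | zero => trivial
  | succ n ih =>
    obtain ⟨u, v, ⟨u', v', h, huv', hvb', hu', hv'⟩, huv, hvb, hu, hv⟩ := h
    exact ⟨v', u, ih ⟨u', v', h, huv', le_rfl, hu', hv'⟩, hvb', huv.trans hvb,
      neg_lt_neg_iff.1 hv', neg_lt_neg_iff.1 hu⟩

theorem HasDownChain.up {x : ℝ≥0 → ℝ} {z : ℝ} (h0 : x 0 < z) {n : ℕ} {b : ℝ≥0}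
    (h : HasDownChain x z n b) : HasDownChain (fun u => -x u) (-z) n b := by
  cases n with
  | zero => trivial
  | succ n =>
    obtain ⟨u, v, h, huv, hvb, hu, hv⟩ := h
    exact (h.up_succ h0 hu).mono (huv.trans hvb)

theorem HasDownChain.of_up {x : ℝ≥0 → ℝ} {z : ℝ} {n : ℕ} {b : ℝ≥0} (hb : x b < z)
    (h : HasDownChain (fun u => -x u) (-z) n b) : HasDownChain x z n b := by
  cases n with
  | zero => trivial
  | succ n =>
    obtain ⟨u, v, h, huv, hvb, hu, hv⟩ := h
    exact ⟨v, b, HasDownChain.of_up_succ ⟨u, v, h, huv, le_rfl, hu, hv⟩, hvb, le_rfl,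
      neg_lt_neg_iff.1 hv, hb⟩

/-- A finite hitting time of a right-continuous path is attained, up to passing to the closure of the
target set. -/
theorem exists_hitTime_eq {x : ℝ≥0 → ℝ} (hx : ∀ t, ContinuousWithinAt x (Ici t) t) {t : ℝ≥0}
    {A : Set ℝ} {a : ℝ≥0∞} (h : hitTime x t A a ≤ t) :
    ∃ u : ℝ≥0, hitTime x t A a = u ∧ a ≤ u ∧ u ≤ t ∧ x u ∈ closure A := by
  set S : Set ℝ≥0 := {u : ℝ≥0 | a ≤ u ∧ u ≤ t ∧ x u ∈ A} with hS
  have hne : S.Nonempty := by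
    by_contra hne
    rw [not_nonempty_iff_eq_empty] at hne
    have : hitTime x t A a = ⊤ := by simp [hitTime, ← hS, hne]
    rw [this] at h
    exact absurd h (by simp)
  have heq : hitTime x t A a = ((sInf S : ℝ≥0) : ℝ≥0∞) := by
    rw [ENNReal.coe_sInf hne, hitTime, sInf_image]
  have hmem : sInf S ∈ closure S := csInf_mem_closure hne (OrderBot.bddBelow S)
  refine ⟨sInf S, heq, ?_, ?_, ?_⟩
  · rw [← heq]
    exact le_sInf (by rintro _ ⟨u, hu, rfl⟩; exact hu.1)
  · exact_mod_cast heq ▸ h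
  · have h1 : ContinuousWithinAt x S (sInf S) :=
      (hx _).mono fun u hu => csInf_le (OrderBot.bddBelow S) hu
    exact h1.mem_closure hmem fun u hu => hu.2.2

theorem hitTime_le {x : ℝ≥0 → ℝ} {t : ℝ≥0} {A : Set ℝ} {a : ℝ≥0∞} {u : ℝ≥0} (ha : a ≤ u)
    (hu : u ≤ t) (h : x u ∈ A) : hitTime x t A a ≤ u :=
  sInf_le ⟨u, ⟨ha, hu, h⟩, rfl⟩

theorem le_hitTime (x : ℝ≥0 → ℝ) (t : ℝ≥0) (A : Set ℝ) (a : ℝ≥0∞) : a ≤ hitTime x t A a :=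
  le_sInf (by rintro _ ⟨u, hu, rfl⟩; exact hu.1)

theorem sigma_monotone (x : ℝ≥0 → ℝ) (s t : ℝ≥0) (z c : ℝ) : Monotone (sigma x s t z c) :=
  monotone_nat_of_le_succ fun _ => (le_hitTime _ _ _ _).trans (le_hitTime _ _ _ _)

theorem exists_hasDownChain_of_sigma_le {x : ℝ≥0 → ℝ} (hx : ∀ t, ContinuousWithinAt x (Ici t) t)
    {t : ℝ≥0} {z c : ℝ} (hc : 0 < c) {n : ℕ} (h : sigma x 0 t z c n ≤ t) :
    ∃ b : ℝ≥0, sigma x 0 t z c n = b ∧ HasDownChain x z n b := by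
  induction n with
  | zero => exact ⟨0, rfl, trivial⟩
  | succ n ih =>
    obtain ⟨v, hv, hτv, hvt, hxv⟩ := exists_hitTime_eq hx h
    obtain ⟨u, hu, hσu, hut, hxu⟩ := exists_hitTime_eq hx (hτv.trans (by exact_mod_cast hvt))
    obtain ⟨b, hb, hch⟩ := ih (hσu.trans (by exact_mod_cast hut))
    rw [closure_Iio, mem_Iic] at hxv
    rw [closure_Ici, mem_Ici] at hxu
    rw [hu] at hτv
    rw [hb] at hσu
    exact ⟨v, hv, u, v, hch.mono (by exact_mod_cast hσu), by exact_mod_cast hτv, le_rfl,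
      by linarith, by linarith⟩

/-- The greedy times `σ` are no later than those of any given chain, once `c` is small. -/
theorem HasDownChain.exists_sigma_le {x : ℝ≥0 → ℝ} {t : ℝ≥0} {z : ℝ} {n : ℕ} {b : ℝ≥0}
    (h : HasDownChain x z n b) (hb : b ≤ t) : ∃ c > 0, sigma x 0 t z c n ≤ b := by
  induction n generalizing b with
  | zero => exact ⟨1, one_pos, by simp [sigma]⟩
  | succ n ih =>
    obtain ⟨u, v, h, huv, hvb, hu, hv⟩ := h
    obtain ⟨c, hc, hσ⟩ := ih h ((huv.trans hvb).trans hb)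
    refine ⟨min c (min (x u - z) (z - x v)), by simp [hc, hu, hv], ?_⟩
    have h1 : min c (min (x u - z) (z - x v)) ≤ x u - z :=
      (min_le_right _ _).trans (min_le_left _ _)
    have h2 : min c (min (x u - z) (z - x v)) ≤ z - x v :=
      (min_le_right _ _).trans (min_le_right _ _)
    refine (hitTime_le (hitTime_le ((sigma_mono x 0 t z (min_le_left _ _) n).trans hσ)
      (huv.trans (hvb.trans hb)) ?_ |>.trans (by exact_mod_cast huv)) (hvb.trans hb) ?_).trans
      (by exact_mod_cast hvb)
    · rw [mem_Ici]; linarith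
    · rw [mem_Iio]; linarith

theorem natCast_le_sSup_iff {S : Set ℕ∞} {n : ℕ} (hn : n ≠ 0) :
    (n : ℕ∞) ≤ sSup S ↔ ∃ m ∈ S, (n : ℕ∞) ≤ m := by
  obtain ⟨k, rfl⟩ := Nat.exists_eq_succ_of_ne_zero hn
  have key (m : ℕ∞) : ((k + 1 : ℕ) : ℕ∞) ≤ m ↔ (k : ℕ∞) < m := by
    rw [Nat.cast_add, Nat.cast_one]
    exact ENat.add_one_le_iff (ENat.natCast_ne_top k)
  simp only [Nat.succ_eq_add_one, key, lt_sSup_iff]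

/-- In the limit of shrinking intervals, the downcrossing number counts downcrossings of the level. -/
theorem natCast_le_down_iff {x : ℝ≥0 → ℝ} (hx : ∀ t, ContinuousWithinAt x (Ici t) t)
    {t : ℝ≥0} {z : ℝ} {n : ℕ} : (n : ℕ∞) ≤ down x 0 t z ↔ HasDownChain x z n t := by
  rcases eq_or_ne n 0 with rfl | hn
  · simp [HasDownChain]
  rw [(tendsto_downInterval x 0 t z).2, natCast_le_sSup_iff hn]
  constructor
  · rintro ⟨_, ⟨c, hc, rfl⟩, h⟩
    obtain ⟨_, ⟨m, hm, rfl⟩, hnm⟩ := (natCast_le_sSup_iff hn).1 h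
    have hσ : sigma x 0 t z c n ≤ t := (sigma_monotone x 0 t z c (Nat.cast_le.1 hnm)).trans hm
    obtain ⟨b, hb, hch⟩ := exists_hasDownChain_of_sigma_le hx hc hσ
    exact hch.mono (by exact_mod_cast hb ▸ hσ)
  · intro h
    obtain ⟨c, hc, hσ⟩ := h.exists_sigma_le le_rfl
    exact ⟨_, ⟨c, hc, rfl⟩, (natCast_le_sSup_iff hn).2 ⟨n, ⟨n, hσ, rfl⟩, le_rfl⟩⟩

theorem natCast_le_up_iff {x : ℝ≥0 → ℝ} (hx : ∀ t, ContinuousWithinAt x (Ici t) t)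
    {t : ℝ≥0} {z : ℝ} {n : ℕ} :
    (n : ℕ∞) ≤ up x 0 t z ↔ HasDownChain (fun u => -x u) (-z) n t :=
  natCast_le_down_iff (x := fun u => -x u) fun t => (hx t).neg

/-- There is at most one upcrossing more than there are downcrossings. -/
theorem up_ne_top_of_down_ne_top {x : ℝ≥0 → ℝ} (hx : ∀ t, ContinuousWithinAt x (Ici t) t)
    {t : ℝ≥0} {z : ℝ} (h : down x 0 t z ≠ ⊤) : up x 0 t z ≠ ⊤ := by
  obtain ⟨d, hd⟩ := ENat.ne_top_iff_exists.1 h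
  intro htop
  have h1 : ((d + 2 : ℕ) : ℕ∞) ≤ up x 0 t z := htop ▸ le_top
  have h2 := (natCast_le_down_iff hx).2 ((natCast_le_up_iff hx).1 h1).of_up_succ
  rw [← hd] at h2
  have : d + 1 ≤ d := by exact_mod_cast h2
  omega

/-- Up- and downcrossings alternate, so their numbers differ by at most one, and the difference is
decided by the positions of the end points of the path relative to the level. -/
theorem netCrossings_eq {x : ℝ≥0 → ℝ} (hx : ∀ t, ContinuousWithinAt x (Ici t) t)
    {t : ℝ≥0} {z : ℝ} (h : down x 0 t z ≠ ⊤) (h0 : x 0 ≠ z) (ht : x t ≠ z) :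
    netCrossings x t z = (if z < x t then 1 else 0) - (if z < x 0 then 1 else 0) := by
  obtain ⟨u, hu⟩ := ENat.ne_top_iff_exists.1 (up_ne_top_of_down_ne_top hx h)
  obtain ⟨d, hd⟩ := ENat.ne_top_iff_exists.1 h
  have hU (n : ℕ) : n ≤ u ↔ HasDownChain (fun u => -x u) (-z) n t := by
    rw [← natCast_le_up_iff hx, ← hu, Nat.cast_le]
  have hD (n : ℕ) : n ≤ d ↔ HasDownChain x z n t := by
    rw [← natCast_le_down_iff hx, ← hd, Nat.cast_le]
  have hD' (n : ℕ) : n ≤ d ↔ HasDownChain (fun u => - -x u) (- -z) n t := by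
    simpa only [neg_neg] using hD n
  have hud : u ≤ d + 1 := by
    rcases u with _ | u
    · omega
    · have := (hD u).2 ((hU (u + 1)).1 le_rfl).of_up_succ
      omega
  have hdu : d ≤ u + 1 := by
    rcases d with _ | d
    · omega
    · have := (hU d).2 ((hD' (d + 1)).1 le_rfl).of_up_succ
      omega
  rw [netCrossings, ← hu, ← hd, ENat.toNat_natCast, ENat.toNat_natCast]
  rcases h0.lt_or_gt with h0 | h0 <;> rcases ht.lt_or_gt with ht | ht
  · have h1 : d ≤ u := (hU d).2 (((hD d).1 le_rfl).up h0)
    have h2 : u ≤ d := (hD u).2 (((hU u).1 le_rfl).of_up ht)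
    simp [ht.not_gt, h0.not_gt, le_antisymm h1 h2]
  · have h1 : d + 1 ≤ u := (hU (d + 1)).2 (((hD d).1 le_rfl).up_succ h0 ht)
    simp [ht, h0.not_gt, le_antisymm hud h1]
  · have h1 : u + 1 ≤ d :=
      (hD' (u + 1)).2 (((hU u).1 le_rfl).up_succ (neg_lt_neg h0) (neg_lt_neg ht))
    simp [ht.not_gt, h0, le_antisymm hdu h1]
  · have h1 : u ≤ d := (hD' u).2 (((hU u).1 le_rfl).up (neg_lt_neg h0))
    have h2 : d ≤ u := (hU d).2 (((hD' d).1 le_rfl).of_up (neg_lt_neg ht))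
    simp [ht, h0, le_antisymm h1 h2]


/-! ### Regular levels -/

/-- The level `z` is regular for `x` if each time at which `x` or its left limit takes the value `z`
is a time of continuous strict passage through `z`. -/
def IsRegularLevel (x : ℝ≥0 → ℝ) (z : ℝ) : Prop :=
  ∀ r, r ∈ incTimes x z r ∨ r ∈ decTimes x z r ∨ (x r ≠ z ∧ Function.leftLim x r ≠ z)

/-- `x` lies above the level `z` just before time `r` (for regular `z`). -/
def AboveBefore (x : ℝ≥0 → ℝ) (z : ℝ) (r : ℝ≥0) : Prop :=
  z < Function.leftLim x r ∨ r ∈ decTimes x z r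

/-- `x` lies above the level `z` just after time `r` (for regular `z`). -/
def AboveAfter (x : ℝ≥0 → ℝ) (z : ℝ) (r : ℝ≥0) : Prop :=
  z < x r ∨ r ∈ incTimes x z r

theorem mem_incTimes_iff_self {x : ℝ≥0 → ℝ} {z : ℝ} {r t : ℝ≥0} :
    r ∈ incTimes x z t ↔ r ∈ incTimes x z r ∧ r ≤ t :=
  ⟨fun h => ⟨⟨h.1, le_rfl, h.2.2⟩, h.2.1⟩, fun h => ⟨h.1.1, h.2, h.1.2.2⟩⟩

theorem mem_decTimes_iff_self {x : ℝ≥0 → ℝ} {z : ℝ} {r t : ℝ≥0} :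
    r ∈ decTimes x z t ↔ r ∈ decTimes x z r ∧ r ≤ t :=
  ⟨fun h => ⟨⟨h.1, le_rfl, h.2.2⟩, h.2.1⟩, fun h => ⟨h.1.1, h.2, h.1.2.2⟩⟩

theorem IsCadlag.tendsto_leftLim {x : ℝ≥0 → ℝ} (hx : IsCadlag x) (r : ℝ≥0) :
    Tendsto x (𝓝[<] r) (𝓝 (Function.leftLim x r)) := by
  rcases eq_or_ne r 0 with rfl | hr
  · simp
  · exact tendsto_leftLim_of_tendsto (hx.2 r (pos_iff_ne_zero.2 hr))

theorem leftLim_eq_of_continuousAt {x : ℝ≥0 → ℝ} {r : ℝ≥0} (h : ContinuousAt x r) :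
    Function.leftLim x r = x r :=
  h.continuousWithinAt.leftLim_eq

theorem eventually_right_of_mem_incTimes {x : ℝ≥0 → ℝ} {z : ℝ} {r t : ℝ≥0}
    (h : r ∈ incTimes x z t) : ∀ᶠ s in 𝓝[>] r, z < x s := by
  filter_upwards [nhdsWithin_le_nhds h.2.2.2.2, self_mem_nhdsWithin] with s hs hrs
  have h1 : (r : ℝ) - s < 0 := sub_neg.2 (NNReal.coe_lt_coe.2 hrs)
  rw [sign_neg h1, sign_eq_neg_one_iff, h.2.2.2.1] at hs
  linarith

theorem eventually_left_of_mem_incTimes {x : ℝ≥0 → ℝ} {z : ℝ} {r t : ℝ≥0}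
    (h : r ∈ incTimes x z t) : ∀ᶠ s in 𝓝[<] r, x s < z := by
  filter_upwards [nhdsWithin_le_nhds h.2.2.2.2, self_mem_nhdsWithin] with s hs hrs
  have h1 : 0 < (r : ℝ) - s := sub_pos.2 (NNReal.coe_lt_coe.2 hrs)
  rw [sign_pos h1, sign_eq_one_iff, h.2.2.2.1] at hs
  linarith

theorem eventually_right_of_mem_decTimes {x : ℝ≥0 → ℝ} {z : ℝ} {r t : ℝ≥0}
    (h : r ∈ decTimes x z t) : ∀ᶠ s in 𝓝[>] r, x s < z := by
  filter_upwards [nhdsWithin_le_nhds h.2.2.2.2, self_mem_nhdsWithin] with s hs hrs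
  have h1 : 0 < (s : ℝ) - r := sub_pos.2 (NNReal.coe_lt_coe.2 hrs)
  rw [sign_pos h1, sign_eq_one_iff, h.2.2.2.1] at hs
  linarith

theorem eventually_left_of_mem_decTimes {x : ℝ≥0 → ℝ} {z : ℝ} {r t : ℝ≥0}
    (h : r ∈ decTimes x z t) : ∀ᶠ s in 𝓝[<] r, z < x s := by
  filter_upwards [nhdsWithin_le_nhds h.2.2.2.2, self_mem_nhdsWithin] with s hs hrs
  have h1 : (s : ℝ) - r < 0 := sub_neg.2 (NNReal.coe_lt_coe.2 hrs)
  rw [sign_neg h1, sign_eq_neg_one_iff, h.2.2.2.1] at hs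
  linarith

theorem notMem_decTimes_of_mem_incTimes {x : ℝ≥0 → ℝ} {z : ℝ} {r t t' : ℝ≥0}
    (h : r ∈ incTimes x z t) : r ∉ decTimes x z t' := by
  intro h'
  obtain ⟨s, hs, hs'⟩ := ((eventually_right_of_mem_incTimes h).and
    (eventually_right_of_mem_decTimes h')).exists
  exact hs.not_gt hs'

theorem leftLim_eq_of_mem_incTimes {x : ℝ≥0 → ℝ} {z : ℝ} {r t : ℝ≥0} (h : r ∈ incTimes x z t) :
    Function.leftLim x r = z :=
  (leftLim_eq_of_continuousAt h.2.2.1).trans h.2.2.2.1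

theorem leftLim_eq_of_mem_decTimes {x : ℝ≥0 → ℝ} {z : ℝ} {r t : ℝ≥0} (h : r ∈ decTimes x z t) :
    Function.leftLim x r = z :=
  (leftLim_eq_of_continuousAt h.2.2.1).trans h.2.2.2.1

theorem IsRegularLevel.eventually_right {x : ℝ≥0 → ℝ} {z : ℝ} (hx : IsCadlag x)
    (hz : IsRegularLevel x z) (r : ℝ≥0) :
    ∀ᶠ s in 𝓝[>] r, x s ≠ z ∧ (z < x s ↔ AboveAfter x z r) := by
  rcases hz r with h | h | ⟨h, -⟩
  · filter_upwards [eventually_right_of_mem_incTimes h] with s hs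
    exact ⟨hs.ne', iff_of_true hs (Or.inr h)⟩
  · filter_upwards [eventually_right_of_mem_decTimes h] with s hs
    refine ⟨hs.ne, iff_of_false hs.not_gt ?_⟩
    rintro (h2 | h2)
    · exact h2.ne' h.2.2.2.1
    · exact notMem_decTimes_of_mem_incTimes h2 h
  · rcases h.lt_or_gt with h | h
    · filter_upwards [((hx.1 r).mono Ioi_subset_Ici_self).eventually_lt_const h] with s hs
      refine ⟨hs.ne, iff_of_false hs.not_gt ?_⟩
      rintro (h2 | h2)
      · exact h2.not_gt h
      · exact h.ne h2.2.2.2.1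
    · filter_upwards [((hx.1 r).mono Ioi_subset_Ici_self).eventually_const_lt h] with s hs
      exact ⟨hs.ne', iff_of_true hs (Or.inl h)⟩

theorem IsRegularLevel.eventually_left {x : ℝ≥0 → ℝ} {z : ℝ} (hx : IsCadlag x)
    (hz : IsRegularLevel x z) (r : ℝ≥0) :
    ∀ᶠ s in 𝓝[<] r, x s ≠ z ∧ (z < x s ↔ AboveBefore x z r) := by
  rcases hz r with h | h | ⟨-, h⟩
  · filter_upwards [eventually_left_of_mem_incTimes h] with s hs
    refine ⟨hs.ne, iff_of_false hs.not_gt ?_⟩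
    rintro (h2 | h2)
    · exact h2.ne' (leftLim_eq_of_mem_incTimes h)
    · exact notMem_decTimes_of_mem_incTimes h h2
  · filter_upwards [eventually_left_of_mem_decTimes h] with s hs
    exact ⟨hs.ne', iff_of_true hs (Or.inr h)⟩
  · rcases h.lt_or_gt with h | h
    · filter_upwards [(hx.tendsto_leftLim r).eventually_lt_const h] with s hs
      refine ⟨hs.ne, iff_of_false hs.not_gt ?_⟩
      rintro (h2 | h2)
      · exact h2.not_gt h
      · exact h.ne (leftLim_eq_of_mem_decTimes h2)
    · filter_upwards [(hx.tendsto_leftLim r).eventually_const_lt h] with s hs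
      exact ⟨hs.ne', iff_of_true hs (Or.inl h)⟩

theorem notMem_incTimes_of_ne {x : ℝ≥0 → ℝ} {z : ℝ} {r t : ℝ≥0} (h : x r ≠ z) :
    r ∉ incTimes x z t := fun h' => h h'.2.2.2.1

theorem aboveAfter_iff_of_ne {x : ℝ≥0 → ℝ} {z : ℝ} {r : ℝ≥0} (h : x r ≠ z) :
    AboveAfter x z r ↔ z < x r :=
  or_iff_left (notMem_incTimes_of_ne h)

/-- If near `s`, to the left, `x` keeps to one side of a regular level and avoids it, then this is the
side on which `x` lies before `s`. -/
theorem IsRegularLevel.aboveBefore_iff {x : ℝ≥0 → ℝ} {z : ℝ} (hx : IsCadlag x)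
    (hz : IsRegularLevel x z) {a s : ℝ≥0} {P : Prop} (has : a < s)
    (h : ∀ q ∈ Ioo a s, z < x q ↔ P) : AboveBefore x z s ↔ P := by
  have : (𝓝[<] s).NeBot := nhdsLT_neBot_of_exists_lt ⟨a, has⟩
  obtain ⟨q, hq, hq'⟩ := ((hz.eventually_left hx s).and (Ioo_mem_nhdsLT has)).exists
  exact hq.2.symm.trans (h q hq')

/-- A regular level is crossed at isolated times only. -/
theorem IsRegularLevel.exists_right {x : ℝ≥0 → ℝ} {z : ℝ} (hx : IsCadlag x)
    (hz : IsRegularLevel x z) (r : ℝ≥0) : ∃ b > r, ∀ q ∈ Ioo r b,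
      (AboveBefore x z q ↔ AboveAfter x z r) ∧ (AboveAfter x z q ↔ AboveAfter x z r) := by
  obtain ⟨b, hb, hI⟩ := mem_nhdsGT_iff_exists_Ioo_subset.1 (hz.eventually_right hx r)
  refine ⟨b, hb, fun q hq => ⟨hz.aboveBefore_iff hx hq.1 fun q' hq' =>
    (hI ⟨hq'.1, hq'.2.trans hq.2⟩).2, ?_⟩⟩
  rw [aboveAfter_iff_of_ne (hI hq).1]
  exact (hI hq).2

theorem IsRegularLevel.exists_left {x : ℝ≥0 → ℝ} {z : ℝ} (hx : IsCadlag x)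
    (hz : IsRegularLevel x z) {r : ℝ≥0} (hr : 0 < r) : ∃ a < r, ∀ q ∈ Ioo a r,
      (AboveBefore x z q ↔ AboveBefore x z r) ∧ (AboveAfter x z q ↔ AboveBefore x z r) := by
  obtain ⟨a, ha, hI⟩ := (mem_nhdsLT_iff_exists_Ioo_subset' hr).1 (hz.eventually_left hx r)
  refine ⟨a, ha, fun q hq => ⟨hz.aboveBefore_iff hx hq.1 fun q' hq' =>
    (hI ⟨hq'.1, hq'.2.trans hq.2⟩).2, ?_⟩⟩
  rw [aboveAfter_iff_of_ne (hI hq).1]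
  exact (hI hq).2

/-- The times in `(0, t]` at which `x` passes from below to above `z`, continuously or by a jump. -/
def upTimes (x : ℝ≥0 → ℝ) (z : ℝ) (t : ℝ≥0) : Set ℝ≥0 :=
  {r | 0 < r ∧ r ≤ t ∧ ¬ AboveBefore x z r ∧ AboveAfter x z r}

/-- The times in `(0, t]` at which `x` passes from above to below `z`, continuously or by a jump. -/
def downTimes (x : ℝ≥0 → ℝ) (z : ℝ) (t : ℝ≥0) : Set ℝ≥0 :=
  {r | 0 < r ∧ r ≤ t ∧ AboveBefore x z r ∧ ¬ AboveAfter x z r}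

/-- The passage times do not accumulate, so there are finitely many in the compact `[0, t]`. -/
theorem IsRegularLevel.finite_crossings {x : ℝ≥0 → ℝ} {z : ℝ} (hx : IsCadlag x)
    (hz : IsRegularLevel x z) (t : ℝ≥0) : (upTimes x z t ∪ downTimes x z t).Finite := by
  set T : Set ℝ≥0 := {q | ¬ (AboveBefore x z q ↔ AboveAfter x z q)} with hT
  have hloc (r : ℝ≥0) : ∃ U ∈ 𝓝 r, U ∩ T ⊆ {r} := by
    obtain ⟨b, hb, hR⟩ := hz.exists_right hx r
    rcases eq_or_ne r 0 with rfl | hr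
    · refine ⟨Iio b, Iio_mem_nhds hb, fun q hq => ?_⟩
      by_contra hne
      have := hR q ⟨pos_iff_ne_zero.2 hne, hq.1⟩
      exact hq.2 (this.1.trans this.2.symm)
    · obtain ⟨a, ha, hL⟩ := hz.exists_left hx (pos_iff_ne_zero.2 hr)
      refine ⟨Ioo a b, Ioo_mem_nhds ha hb, fun q hq => ?_⟩
      by_contra hne
      rcases lt_or_gt_of_ne hne with h | h
      · have := hL q ⟨hq.1.1, h⟩
        exact hq.2 (this.1.trans this.2.symm)
      · have := hR q ⟨h, hq.1.2⟩
        exact hq.2 (this.1.trans this.2.symm)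
  choose U hU hUT using hloc
  obtain ⟨F, -, hF⟩ := (isCompact_Icc (a := (0 : ℝ≥0)) (b := t)).elim_nhds_subcover U
    fun r _ => hU r
  refine F.finite_toSet.subset ?_
  intro q hq
  have hqT : q ∈ T := by
    rcases hq with hq | hq
    · exact fun h => hq.2.2.1 (h.2 hq.2.2.2)
    · exact fun h => hq.2.2.2 (h.1 hq.2.2.1)
  have hqt : q ≤ t := hq.elim (fun h => h.2.1) (fun h => h.2.1)
  obtain ⟨r, hr, hqr⟩ := mem_iUnion₂.1 (hF ⟨zero_le, hqt⟩)
  have : q = r := hUT r ⟨hqr, hqT⟩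
  exact this ▸ hr

open Classical in
/-- The balance of a regular level: the state after time `s` minus the net number of passages up to
`s`. -/
noncomputable def balance (x : ℝ≥0 → ℝ) (z : ℝ) (s : ℝ≥0) : ℝ :=
  (if AboveAfter x z s then 1 else 0) - ((upTimes x z s).ncard - (downTimes x z s).ncard)

theorem upTimes_eq_of_forall {x : ℝ≥0 → ℝ} {z : ℝ} {s r : ℝ≥0} (hsr : s ≤ r)
    (h : ∀ q ∈ Ioc s r, AboveBefore x z q ↔ AboveAfter x z q) : upTimes x z r = upTimes x z s := by
  ext q
  refine ⟨fun hq => ⟨hq.1, ?_, hq.2.2⟩, fun hq => ⟨hq.1, hq.2.1.trans hsr, hq.2.2⟩⟩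
  by_contra hqs
  exact hq.2.2.1 ((h q ⟨not_le.1 hqs, hq.2.1⟩).2 hq.2.2.2)

theorem downTimes_eq_of_forall {x : ℝ≥0 → ℝ} {z : ℝ} {s r : ℝ≥0} (hsr : s ≤ r)
    (h : ∀ q ∈ Ioc s r, AboveBefore x z q ↔ AboveAfter x z q) :
    downTimes x z r = downTimes x z s := by
  ext q
  refine ⟨fun hq => ⟨hq.1, ?_, hq.2.2⟩, fun hq => ⟨hq.1, hq.2.1.trans hsr, hq.2.2⟩⟩
  by_contra hqs
  exact hq.2.2.2 ((h q ⟨not_le.1 hqs, hq.2.1⟩).1 hq.2.2.1)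

/-- The balance is locally constant: on either side of `r` no passage occurs nearby, and a passage at `r`
changes the state and the net number of passages by the same amount. -/
theorem IsRegularLevel.balance_eventually_eq {x : ℝ≥0 → ℝ} {z : ℝ} (hx : IsCadlag x)
    (hz : IsRegularLevel x z) (r : ℝ≥0) : ∀ᶠ s in 𝓝 r, balance x z s = balance x z r := by
  classical
  have hright : ∃ b > r, ∀ s, r ≤ s → s < b → balance x z s = balance x z r := by
    obtain ⟨b, hb, hR⟩ := hz.exists_right hx r
    refine ⟨b, hb, fun s hrs hsb => ?_⟩
    have h (q) (hq : q ∈ Ioc r s) : AboveBefore x z q ↔ AboveAfter x z q :=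
      (hR q ⟨hq.1, hq.2.trans_lt hsb⟩).1.trans (hR q ⟨hq.1, hq.2.trans_lt hsb⟩).2.symm
    rw [balance, balance, upTimes_eq_of_forall hrs h, downTimes_eq_of_forall hrs h]
    rcases hrs.eq_or_lt with rfl | hrs
    · rfl
    · simp only [(hR s ⟨hrs, hsb⟩).2]
  obtain ⟨b, hb, hR⟩ := hright
  rcases eq_or_ne r 0 with rfl | hr
  · filter_upwards [Iio_mem_nhds hb] with s hs using hR s zero_le hs
  obtain ⟨a, ha, hL⟩ := hz.exists_left hx (pos_iff_ne_zero.2 hr)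
  filter_upwards [Ioo_mem_nhds ha hb] with s hs
  rcases le_or_gt r s with hrs | hsr
  · exact hR s hrs hs.2
  have hfin := hz.finite_crossings hx s
  have hsplit (q : ℝ≥0) (hq : ¬ (AboveBefore x z q ↔ AboveAfter x z q)) :
      q ≤ r ↔ q = r ∨ q ≤ s := by
    refine ⟨fun h => ?_, fun h => h.elim (fun h => h.le) fun h => h.trans hsr.le⟩
    rcases h.eq_or_lt with h | h
    · exact Or.inl h
    · right
      by_contra hsq
      have := hL q ⟨hs.1.trans (not_le.1 hsq), h⟩
      exact hq (this.1.trans this.2.symm)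
  have hs' := (hL s ⟨hs.1, hsr⟩).2
  have hr0 : 0 < r := pos_iff_ne_zero.2 hr
  have hup : upTimes x z r =
      if ¬ AboveBefore x z r ∧ AboveAfter x z r then insert r (upTimes x z s)
      else upTimes x z s := by
    ext q
    have h1 : q ∈ upTimes x z r ↔
        (q = r ∧ ¬ AboveBefore x z r ∧ AboveAfter x z r) ∨ q ∈ upTimes x z s := by
      constructor
      · rintro ⟨h1, h2, h3, h4⟩
        rcases (hsplit q fun h => h3 (h.2 h4)).1 h2 with rfl | h
        · exact Or.inl ⟨rfl, h3, h4⟩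
        · exact Or.inr ⟨h1, h, h3, h4⟩
      · rintro (⟨rfl, h3, h4⟩ | h)
        · exact ⟨hr0, le_rfl, h3, h4⟩
        · exact ⟨h.1, h.2.1.trans hsr.le, h.2.2⟩
    rw [h1]
    split_ifs with h
    · simp [h]
    · simp [h]
  have hdown : downTimes x z r =
      if AboveBefore x z r ∧ ¬ AboveAfter x z r then insert r (downTimes x z s)
      else downTimes x z s := by
    ext q
    have h1 : q ∈ downTimes x z r ↔
        (q = r ∧ AboveBefore x z r ∧ ¬ AboveAfter x z r) ∨ q ∈ downTimes x z s := by
      constructor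
      · rintro ⟨h1, h2, h3, h4⟩
        rcases (hsplit q fun h => h4 (h.1 h3)).1 h2 with rfl | h
        · exact Or.inl ⟨rfl, h3, h4⟩
        · exact Or.inr ⟨h1, h, h3, h4⟩
      · rintro (⟨rfl, h3, h4⟩ | h)
        · exact ⟨hr0, le_rfl, h3, h4⟩
        · exact ⟨h.1, h.2.1.trans hsr.le, h.2.2⟩
    rw [h1]
    split_ifs with h
    · simp [h]
    · simp [h]
  have hu : r ∉ upTimes x z s := fun h => hsr.not_ge h.2.1
  have hd : r ∉ downTimes x z s := fun h => hsr.not_ge h.2.1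
  have hcu := ncard_insert_of_notMem hu (hfin.subset subset_union_left)
  have hcd := ncard_insert_of_notMem hd (hfin.subset subset_union_right)
  rw [balance, balance, hup, hdown]
  simp only [hs']
  by_cases h1 : AboveBefore x z r <;> by_cases h2 : AboveAfter x z r <;>
    simp [h1, h2, hcu, hcd] <;> ring

/-- Since `ℝ≥0` is connected, the locally constant balance of a regular level is constant. -/
theorem IsRegularLevel.balance_eq {x : ℝ≥0 → ℝ} {z : ℝ} (hx : IsCadlag x)
    (hz : IsRegularLevel x z) (s r : ℝ≥0) : balance x z s = balance x z r :=
  ((IsLocallyConstant.iff_eventually_eq _).2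
    (hz.balance_eventually_eq hx)).apply_eq_of_preconnectedSpace s r

theorem IsRegularLevel.ncard_sub_ncard {x : ℝ≥0 → ℝ} {z : ℝ} (hx : IsCadlag x)
    (hz : IsRegularLevel x z) {t : ℝ≥0} (h0 : x 0 ≠ z) (ht : x t ≠ z) :
    ((upTimes x z t).ncard : ℝ) - (downTimes x z t).ncard =
      (if z < x t then 1 else 0) - (if z < x 0 then 1 else 0) := by
  have h := hz.balance_eq hx t 0
  have hu : upTimes x z 0 = ∅ :=
    eq_empty_of_forall_notMem fun q hq => hq.1.not_ge hq.2.1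
  have hd : downTimes x z 0 = ∅ :=
    eq_empty_of_forall_notMem fun q hq => hq.1.not_ge hq.2.1
  simp only [balance, hu, hd, aboveAfter_iff_of_ne h0, aboveAfter_iff_of_ne ht, ncard_empty,
    Nat.cast_zero, sub_zero] at h
  linarith

/-- Each downcrossing takes up a passage time of its own. -/
theorem IsRegularLevel.le_ncard_of_hasDownChain {x : ℝ≥0 → ℝ} {z : ℝ} (hx : IsCadlag x)
    (hz : IsRegularLevel x z) {n : ℕ} {b : ℝ≥0} (h : HasDownChain x z n b) :
    n ≤ (upTimes x z b ∪ downTimes x z b).ncard := by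
  induction n generalizing b with
  | zero => exact Nat.zero_le _
  | succ n ih =>
    obtain ⟨u, v, h, huv, hvb, hu, hv⟩ := h
    obtain ⟨q, hq, hqT⟩ : ∃ q ∈ Ioc u v, ¬ (AboveBefore x z q ↔ AboveAfter x z q) := by
      by_contra! hcon
      have h1 := hz.balance_eq hx v u
      rw [balance, balance, upTimes_eq_of_forall huv hcon, downTimes_eq_of_forall huv hcon] at h1
      simp [aboveAfter_iff_of_ne hu.ne', aboveAfter_iff_of_ne hv.ne, hu, hv.not_gt] at h1
      linarith
    have hqu : q ∉ upTimes x z u ∪ downTimes x z u := fun h' =>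
      hq.1.not_ge (h'.elim (fun h => h.2.1) fun h => h.2.1)
    have hq0 : 0 < q := pos_of_gt hq.1
    have hqb : q ∈ upTimes x z b ∪ downTimes x z b := by
      by_cases h1 : AboveBefore x z q <;> by_cases h2 : AboveAfter x z q
      · exact absurd (iff_of_true h1 h2) hqT
      · exact Or.inr ⟨hq0, hq.2.trans hvb, h1, h2⟩
      · exact Or.inl ⟨hq0, hq.2.trans hvb, h1, h2⟩
      · exact absurd (iff_of_false h1 h2) hqT
    calc n + 1 ≤ (upTimes x z u ∪ downTimes x z u).ncard + 1 := Nat.add_le_add_right (ih h) 1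
      _ = (insert q (upTimes x z u ∪ downTimes x z u)).ncard :=
        (ncard_insert_of_notMem hqu (hz.finite_crossings hx u)).symm
      _ ≤ _ := by
        refine ncard_le_ncard (insert_subset hqb (union_subset_union ?_ ?_))
          (hz.finite_crossings hx b)
        · exact fun p hp => ⟨hp.1, hp.2.1.trans (huv.trans hvb), hp.2.2⟩
        · exact fun p hp => ⟨hp.1, hp.2.1.trans (huv.trans hvb), hp.2.2⟩

theorem IsRegularLevel.down_ne_top {x : ℝ≥0 → ℝ} {z : ℝ} (hx : IsCadlag x)
    (hz : IsRegularLevel x z) (t : ℝ≥0) : down x 0 t z ≠ ⊤ := by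
  intro htop
  have h : (((upTimes x z t ∪ downTimes x z t).ncard + 1 : ℕ) : ℕ∞) ≤ down x 0 t z :=
    htop ▸ le_top
  have := hz.le_ncard_of_hasDownChain hx ((natCast_le_down_iff hx.1).1 h)
  omega

theorem incTimes_subset_upTimes {x : ℝ≥0 → ℝ} {z : ℝ} {t : ℝ≥0} :
    incTimes x z t ⊆ upTimes x z t := by
  intro r hr
  refine ⟨hr.1, hr.2.1, ?_, Or.inr (mem_incTimes_iff_self.1 hr).1⟩
  rintro (h | h)
  · exact h.ne' (leftLim_eq_of_mem_incTimes hr)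
  · exact notMem_decTimes_of_mem_incTimes hr h

theorem decTimes_subset_downTimes {x : ℝ≥0 → ℝ} {z : ℝ} {t : ℝ≥0} :
    decTimes x z t ⊆ downTimes x z t := by
  intro r hr
  refine ⟨hr.1, hr.2.1, Or.inr (mem_decTimes_iff_self.1 hr).1, ?_⟩
  rintro (h | h)
  · exact h.ne' hr.2.2.2.1
  · exact notMem_decTimes_of_mem_incTimes h hr

/-- The times in `(0, t]` at which `x` jumps upwards across the level `z`. -/
def jumpUpTimes (x : ℝ≥0 → ℝ) (z : ℝ) (t : ℝ≥0) : Set ℝ≥0 :=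
  {r | 0 < r ∧ r ≤ t ∧ Function.leftLim x r < z ∧ z < x r}

/-- The times in `(0, t]` at which `x` jumps downwards across the level `z`. -/
def jumpDownTimes (x : ℝ≥0 → ℝ) (z : ℝ) (t : ℝ≥0) : Set ℝ≥0 :=
  {r | 0 < r ∧ r ≤ t ∧ x r < z ∧ z < Function.leftLim x r}

theorem IsRegularLevel.upTimes_eq {x : ℝ≥0 → ℝ} {z : ℝ} (hz : IsRegularLevel x z) (t : ℝ≥0) :
    upTimes x z t = incTimes x z t ∪ jumpUpTimes x z t := by
  refine Subset.antisymm ?_ (union_subset incTimes_subset_upTimes ?_)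
  · rintro r ⟨h0, ht, hb, ha⟩
    rcases hz r with h | h | h
    · exact Or.inl (mem_incTimes_iff_self.2 ⟨h, ht⟩)
    · exact absurd (Or.inr h) hb
    · exact Or.inr ⟨h0, ht, lt_of_le_of_ne (not_lt.1 fun h' => hb (Or.inl h')) h.2,
        (aboveAfter_iff_of_ne h.1).1 ha⟩
  · rintro r ⟨h0, ht, h1, h2⟩
    refine ⟨h0, ht, ?_, Or.inl h2⟩
    rintro (h | h)
    · exact h.not_gt h1
    · exact h1.ne (leftLim_eq_of_mem_decTimes h)

theorem IsRegularLevel.downTimes_eq {x : ℝ≥0 → ℝ} {z : ℝ} (hz : IsRegularLevel x z) (t : ℝ≥0) :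
    downTimes x z t = decTimes x z t ∪ jumpDownTimes x z t := by
  refine Subset.antisymm ?_ (union_subset decTimes_subset_downTimes ?_)
  · rintro r ⟨h0, ht, hb, ha⟩
    rcases hz r with h | h | h
    · exact absurd (Or.inr h) ha
    · exact Or.inl (mem_decTimes_iff_self.2 ⟨h, ht⟩)
    · refine Or.inr ⟨h0, ht, lt_of_le_of_ne (not_lt.1 fun h' => ha (Or.inl h')) h.1, ?_⟩
      exact hb.resolve_right fun h' => h.2 (leftLim_eq_of_mem_decTimes h')
  · rintro r ⟨h0, ht, h1, h2⟩
    refine ⟨h0, ht, Or.inl h2, ?_⟩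
    rintro (h | h)
    · exact h.not_gt h1
    · exact h1.ne h.2.2.2.1

/-- At a regular level the net number of crossings is the local time plus the net number of jumps
across the level. -/
theorem IsRegularLevel.netCrossings_eq_localTime_add {x : ℝ≥0 → ℝ} {z : ℝ} (hx : IsCadlag x)
    (hz : IsRegularLevel x z) {t : ℝ≥0} (h0 : x 0 ≠ z) (ht : x t ≠ z) :
    netCrossings x t z = localTime x t z +
      (((jumpUpTimes x z t).ncard : ℝ) - (jumpDownTimes x z t).ncard) := by
  rw [netCrossings_eq hx.1 (hz.down_ne_top hx t) h0 ht, ← hz.ncard_sub_ncard hx h0 ht, localTime]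
  have hfin := hz.finite_crossings hx t
  rw [hz.upTimes_eq, hz.downTimes_eq] at hfin ⊢
  rw [ncard_union_eq _ (hfin.subset fun r hr => Or.inl (Or.inl hr))
      (hfin.subset fun r hr => Or.inl (Or.inr hr)),
    ncard_union_eq _ (hfin.subset fun r hr => Or.inr (Or.inl hr))
      (hfin.subset fun r hr => Or.inr (Or.inr hr))]
  · push_cast; ring
  · exact disjoint_left.2 fun r h h' => h'.2.2.1.ne h.2.2.2.1
  · exact disjoint_left.2 fun r h h' => h'.2.2.2.ne' h.2.2.2.1


/-! ### Almost every level is regular -/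

/-- A Lipschitz function on the line has a nonzero derivative at every point of almost every level
set: the set of points of nondifferentiability is null and so is its image, and the critical values
form a null set. -/
theorem ae_forall_exists_hasDerivAt_ne_zero {h : ℝ → ℝ} {K : ℝ≥0} (hh : LipschitzWith K h) :
    ∀ᵐ z : ℝ, ∀ y, h y = z → ∃ d ≠ 0, HasDerivAt h d y := by
  have h1 : volume (h '' {y | ¬ DifferentiableAt ℝ h y}) = 0 := by
    have hnull : volume {y | ¬ DifferentiableAt ℝ h y} = 0 := hh.ae_differentiableAt_real
    rw [← hausdorffMeasure_real] at hnull ⊢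
    have := (hh.lipschitzOnWith (s := {y | ¬ DifferentiableAt ℝ h y})).hausdorffMeasure_image_le
      (d := 1) zero_le_one
    rw [hnull, mul_zero] at this
    exact le_antisymm this zero_le
  have h2 : volume (h '' {y | HasDerivAt h 0 y}) = 0 := by
    refine addHaar_image_eq_zero_of_det_fderivWithin_eq_zero (f' := fun _ => 0) volume ?_ ?_
    · intro y hy
      have := (HasDerivAt.hasFDerivAt hy).hasFDerivWithinAt (s := {y | HasDerivAt h 0 y})
      simpa using this
    · intro y _
      simp [ContinuousLinearMap.det]
  filter_upwards [measure_eq_zero_iff_ae_notMem.1 h1, measure_eq_zero_iff_ae_notMem.1 h2]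
    with z hz1 hz2 y hy
  have hd : DifferentiableAt ℝ h y := by
    by_contra hd
    exact hz1 ⟨y, hd, hy⟩
  refine ⟨deriv h y, fun h0 => hz2 ⟨y, ?_, hy⟩, hd.hasDerivAt⟩
  have := hd.hasDerivAt
  rwa [h0] at this

theorem eventually_sign_sub_of_hasDerivAt {h : ℝ → ℝ} {y d : ℝ} (hd : HasDerivAt h d y)
    (hd0 : d ≠ 0) : ∀ᶠ w in 𝓝 y, SignType.sign (h y - h w) =
      SignType.sign d * SignType.sign (y - w) := by
  have h1 : ∀ᶠ w in 𝓝[≠] y, SignType.sign (slope h y w) = SignType.sign d := by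
    have h2 := hasDerivAt_iff_tendsto_slope.1 hd
    rcases hd0.lt_or_gt with h0 | h0
    · filter_upwards [h2.eventually_lt_const h0] with w hw
      rw [sign_neg h0, sign_neg hw]
    · filter_upwards [h2.eventually_const_lt h0] with w hw
      rw [sign_pos h0, sign_pos hw]
  rw [eventually_nhdsWithin_iff] at h1
  filter_upwards [h1] with w hw
  rcases eq_or_ne w y with rfl | hne
  · simp
  · rw [← hw hne, ← sign_mul]
    congr 1
    have := sub_smul_slope h y w
    rw [smul_eq_mul, vsub_eq_sub] at this
    linarith

theorem exists_monotone_abs_sub_le {x : ℝ≥0 → ℝ} (hx : LocallyBoundedVariationOn x univ) :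
    ∃ v : ℝ≥0 → ℝ, Monotone v ∧ ∀ a b, a ≤ b → |x b - x a| ≤ v b - v a := by
  refine ⟨variationOnFromTo x univ 0, ?_, ?_⟩
  · rw [← monotoneOn_univ]
    exact variationOnFromTo.monotoneOn hx (mem_univ 0)
  · intro a b hab
    exact variationOnFromTo.abs_sub_le_sub_of_le hx (mem_univ _) (mem_univ _) (mem_univ _) hab

/-- A path whose increments are dominated by those of `v` is a `1`-Lipschitz function of `v`, extended from
the range of `v` to the line. -/
theorem exists_lipschitzWith_comp {x v : ℝ≥0 → ℝ}
    (hxv : ∀ a b, a ≤ b → |x b - x a| ≤ v b - v a) :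
    ∃ h : ℝ → ℝ, LipschitzWith 1 h ∧ ∀ s, h (v s) = x s := by
  have hxv' (a b : ℝ≥0) : |x a - x b| ≤ |v a - v b| := by
    rcases le_total a b with hab | hab
    · rw [abs_sub_comm, abs_sub_comm (v a)]
      exact (hxv a b hab).trans (le_abs_self _)
    · exact (hxv b a hab).trans (le_abs_self _)
  have hinv (s : ℝ≥0) : x (Function.invFun v (v s)) = x s := by
    have h1 := hxv' (Function.invFun v (v s)) s
    rw [Function.invFun_eq (f := v) ⟨s, rfl⟩, sub_self, abs_zero] at h1
    exact sub_eq_zero.1 (abs_nonpos_iff.1 h1)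
  have hL : LipschitzOnWith 1 (fun y => x (Function.invFun v y)) (range v) := by
    refine LipschitzOnWith.of_dist_le_mul ?_
    rintro _ ⟨a, rfl⟩ _ ⟨b, rfl⟩
    simp only [hinv, Real.dist_eq, NNReal.coe_one, one_mul]
    exact hxv' a b
  obtain ⟨h, hh, heq⟩ := hL.extend_real
  exact ⟨h, hh, fun s => ((heq (mem_range_self s)).symm.trans (hinv s))⟩

/-- Write `x = h ∘ v` with `v` monotone and `h` Lipschitz. Outside a countable set of levels, `x` can
meet the level `z` at time `r` only if `v` is continuous and injective at `r`, and for almost every `z`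
the derivative of `h` at `v r` does not vanish; then `x` passes strictly through `z` at `r`. -/
theorem ae_isRegularLevel {x : ℝ≥0 → ℝ} (hx : LocallyBoundedVariationOn x univ) :
    ∀ᵐ z : ℝ, IsRegularLevel x z := by
  obtain ⟨v, hv, hxv⟩ := exists_monotone_abs_sub_le hx
  obtain ⟨h, hh, hhv⟩ := exists_lipschitzWith_comp hxv
  have hD := hv.countable_not_continuousAt
  have hP := hv.countable_setOfPred_two_preimages
  filter_upwards [ae_forall_exists_hasDerivAt_ne_zero hh,
    (hD.image x).ae_notMem volume, (hD.image (Function.leftLim x)).ae_notMem volume,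
    (hP.image h).ae_notMem volume, (countable_singleton (x 0)).ae_notMem volume]
    with z hz hzx hzl hzp hz0 r
  by_cases hvr : ContinuousAt v r
  swap
  · exact Or.inr (Or.inr ⟨fun h' => hzx ⟨r, hvr, h'⟩, fun h' => hzl ⟨r, hvr, h'⟩⟩)
  have hxc : ContinuousAt x r := by
    have := hh.continuous.continuousAt.comp (f := v) hvr
    exact this.congr (Eventually.of_forall hhv)
  rw [leftLim_eq_of_continuousAt hxc, and_self, ← or_assoc]
  by_cases hxr : x r = z
  swap
  · exact Or.inr hxr
  left
  have hr0 : 0 < r := by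
    refine pos_iff_ne_zero.2 fun h' => hz0 ?_
    rw [mem_singleton_iff, ← hxr, h']
  obtain ⟨d, hd0, hd⟩ := hz (v r) ((hhv r).trans hxr)
  have hsv (s : ℝ≥0) : SignType.sign (v r - v s) = SignType.sign ((r : ℝ) - s) := by
    have hne {a b : ℝ≥0} (hab : a < b) (hr : a = r ∨ b = r) : v a < v b := by
      refine lt_of_le_of_ne (hv hab.le) fun he => hzp ⟨v r, ?_, (hhv r).trans hxr⟩
      rcases hr with rfl | rfl
      · exact ⟨a, b, hab, rfl, he.symm⟩
      · exact ⟨a, b, hab, he, rfl⟩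
    rcases lt_trichotomy r s with hrs | rfl | hrs
    · rw [sign_neg (sub_neg.2 (hne hrs (Or.inl rfl))), sign_neg (sub_neg.2 (by exact_mod_cast hrs))]
    · simp
    · rw [sign_pos (sub_pos.2 (hne hrs (Or.inr rfl))), sign_pos (sub_pos.2 (by exact_mod_cast hrs))]
  have key : ∀ᶠ s in 𝓝 r, SignType.sign (x r - x s) =
      SignType.sign d * SignType.sign ((r : ℝ) - s) := by
    filter_upwards [hvr.eventually (eventually_sign_sub_of_hasDerivAt hd hd0)] with s hs
    rwa [hhv, hhv, hsv] at hs
  rcases hd0.lt_or_gt with h0 | h0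
  · refine Or.inr ⟨hr0, le_rfl, hxc, hxr, key.mono fun s hs => ?_⟩
    rw [hs, sign_neg h0, ← neg_sub (r : ℝ) s, Left.sign_neg, neg_one_mul]
  · refine Or.inl ⟨hr0, le_rfl, hxc, hxr, key.mono fun s hs => ?_⟩
    rw [hs, sign_pos h0, one_mul]

/-! ### Summability of the jumps -/

/-- The jumps of `x` in `(0, t]` are absolutely summable: they are dominated by the jumps of the
variation function `v`, whose gaps `(v (s-), v s)` are disjoint subintervals of `[v 0, v t]`. -/
theorem summable_jump {x : ℝ≥0 → ℝ} (hx : IsCadlagLFV x) (t : ℝ≥0) :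
    Summable fun s : jumpTimes x t => |jump x s| := by
  obtain ⟨v, hv, hxv⟩ := exists_monotone_abs_sub_le hx.2
  let I (s : jumpTimes x t) : Set ℝ := Ioo (Function.leftLim v s) (v s)
  have hI : Pairwise (Function.onFun Disjoint I) := by
    have hlt {a b : jumpTimes x t} (hab : (a : ℝ≥0) < b) : Disjoint (I a) (I b) := by
      refine disjoint_left.2 fun y hya hyb => ?_
      exact ((hya.2.trans_le (hv.le_leftLim hab)).trans hyb.1).false
    intro a b hab
    rcases lt_or_gt_of_ne (fun h => hab (Subtype.ext h)) with h | h
    · exact hlt h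
    · exact (hlt h).symm
  have hjump (s : jumpTimes x t) : |jump x s| ≤ v s - Function.leftLim v s := by
    have hne : (𝓝[<] (s : ℝ≥0)).NeBot := nhdsLT_neBot_of_exists_lt ⟨0, s.2.1⟩
    have h1 := ((tendsto_const_nhds (x := x s)).sub (hx.1.tendsto_leftLim s)).abs
    have h2 := (tendsto_const_nhds (x := v s)).sub (hv.tendsto_leftLim (s : ℝ≥0))
    refine le_of_tendsto_of_tendsto h1 h2 ?_
    filter_upwards [self_mem_nhdsWithin] with a ha using hxv a s (le_of_lt ha)
  have hsum : Summable fun s : jumpTimes x t => v s - Function.leftLim v s := by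
    have h0 (s : jumpTimes x t) : 0 ≤ v s - Function.leftLim v s :=
      sub_nonneg.2 (hv.leftLim_le le_rfl)
    have hle : ∑' s : jumpTimes x t, volume (I s) ≤ volume (Icc (v 0) (v t)) :=
      (tsum_meas_le_meas_iUnion_of_disjoint volume (fun _ => measurableSet_Ioo) hI).trans
        (measure_mono (iUnion_subset fun s y hy =>
          ⟨(hv.le_leftLim s.2.1).trans hy.1.le, hy.2.le.trans (hv s.2.2.1)⟩))
    have hfin : ∑' s : jumpTimes x t, ENNReal.ofReal (v s - Function.leftLim v s) ≠ ⊤ := by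
      refine ne_top_of_le_ne_top ?_ ((tsum_congr fun s => ?_).trans_le hle)
      · simp
      · simp [I]
    have := ENNReal.summable_toReal hfin
    refine this.congr fun s => ?_
    exact (ENNReal.toReal_ofReal (h0 s))
  exact hsum.of_nonneg_of_le (fun _ => abs_nonneg _) hjump

theorem countable_jumpTimes {x : ℝ≥0 → ℝ} (hx : IsCadlagLFV x) (t : ℝ≥0) :
    (jumpTimes x t).Countable := by
  have h := (summable_jump hx t).countable_support
  -- All terms of the convergent sum of the absolute jumps are nonzero.
  have huniv : Function.support (fun s : jumpTimes x t => |jump x s|) = univ :=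
    eq_univ_of_forall fun s => abs_ne_zero.2 s.2.2.2
  rw [huniv, countable_univ_iff] at h
  exact h

/-! ### The change of variable formula -/

/-- The signed indicator of the interval between `a` and `b`: `1` on `(a, b]` if `a ≤ b`, and `-1` on
`(b, a]` otherwise. -/
noncomputable def between (a b z : ℝ) : ℝ :=
  (Ioc a b).indicator 1 z - (Ioc b a).indicator 1 z

theorem integrable_between_mul {g : ℝ → ℝ} (hg : LocallyIntegrable g volume) (a b : ℝ) :
    Integrable (fun z => between a b z * g z) := by
  have h (a b : ℝ) : Integrable ((Ioc a b).indicator g) :=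
    (integrable_indicator_iff measurableSet_Ioc).2
      ((hg.integrableOn_isCompact isCompact_Icc).mono_set Ioc_subset_Icc_self)
  refine ((h a b).sub (h b a)).congr (Eventually.of_forall fun z => ?_)
  simp only [between, Pi.sub_apply, indicator_apply, Pi.one_apply, sub_mul, ite_mul, one_mul,
    zero_mul]

theorem integral_between_mul {g : ℝ → ℝ} (hg : LocallyIntegrable g volume) (a b : ℝ) :
    ∫ z, between a b z * g z = ∫ z in a..b, g z := by
  have h (a b : ℝ) : Integrable ((Ioc a b).indicator g) :=
    (integrable_indicator_iff measurableSet_Ioc).2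
      ((hg.integrableOn_isCompact isCompact_Icc).mono_set Ioc_subset_Icc_self)
  rw [intervalIntegral, ← integral_indicator measurableSet_Ioc,
    ← integral_indicator measurableSet_Ioc, ← integral_sub (h a b) (h b a)]
  refine integral_congr_ae (Eventually.of_forall fun z => ?_)
  simp only [between, indicator_apply, Pi.one_apply, sub_mul, ite_mul, one_mul, zero_mul]

theorem between_eq_of_ne {a b z : ℝ} (ha : a ≠ z) (hb : b ≠ z) :
    between a b z = (if z < b then 1 else 0) - (if z < a then 1 else 0) := by
  rcases ha.lt_or_gt with ha | ha <;> rcases hb.lt_or_gt with hb | hb <;>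
    simp [between, ha, hb, ha.le, hb.le, ha.not_gt, hb.not_gt, ha.not_ge, hb.not_ge]

theorem norm_between_mul_le {g : ℝ → ℝ} {a b R C : ℝ} (ha : |a| ≤ R) (hb : |b| ≤ R)
    (hC : ∀ z, |z| ≤ R → |g z| ≤ C) (z : ℝ) :
    ‖between a b z * g z‖ ≤ (uIoc a b).indicator (fun _ => C) z := by
  rcases le_total a b with hab | hab
  · rw [uIoc_of_le hab]
    by_cases hz : z ∈ Ioc a b
    · have : |z| ≤ R := abs_le.2 ⟨(abs_le.1 ha).1.trans hz.1.le, hz.2.trans (abs_le.1 hb).2⟩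
      simpa [between, hz, Ioc_eq_empty_of_le hab] using hC z this
    · simp [between, hz, Ioc_eq_empty_of_le hab]
  · rw [uIoc_of_ge hab]
    by_cases hz : z ∈ Ioc b a
    · have : |z| ≤ R := abs_le.2 ⟨(abs_le.1 hb).1.trans hz.1.le, hz.2.trans (abs_le.1 ha).2⟩
      simpa [between, hz, Ioc_eq_empty_of_le hab] using hC z this
    · simp [between, hz, Ioc_eq_empty_of_le hab]

theorem integral_norm_between_mul_le {g : ℝ → ℝ} {a b R C : ℝ} (ha : |a| ≤ R) (hb : |b| ≤ R)
    (hC : ∀ z, |z| ≤ R → |g z| ≤ C) :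
    ∫ z, ‖between a b z * g z‖ ≤ C * |b - a| := by
  have hint : Integrable ((uIoc a b).indicator (fun _ : ℝ => C)) :=
    (integrable_indicator_iff measurableSet_uIoc).2 (by
      rw [uIoc]; exact integrableOn_const (by simp))
  refine (integral_mono_of_nonneg (Eventually.of_forall fun _ => norm_nonneg _) hint
    (Eventually.of_forall (norm_between_mul_le ha hb hC))).trans_eq ?_
  rw [integral_indicator measurableSet_uIoc, setIntegral_const, smul_eq_mul, mul_comm, Measure.real,
    uIoc, Real.volume_Ioc, ENNReal.toReal_ofReal (by simp), max_sub_min_eq_abs]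


theorem integrable_tsum_of_summable_integral_norm {ι : Type*} [Countable ι] {F : ι → ℝ → ℝ}
    (hF : ∀ i, Integrable (F i)) (hsum : Summable fun i => ∫ z, ‖F i z‖)
    (hae : ∀ᵐ z, Summable fun i => F i z) : Integrable fun z => ∑' i, F i z := by
  constructor
  · refine aestronglyMeasurable_of_tendsto_ae (u := (atTop : Filter (Finset ι)))
      (f := fun A z => ∑ i ∈ A, F i z) (fun A => ?_) (hae.mono fun z hz => hz.hasSum)
    exact Finset.aestronglyMeasurable_fun_sum A fun i _ => (hF i).1
  · have h1 : ∫⁻ z, ‖∑' i, F i z‖ₑ ≤ ∑' i, ∫⁻ z, ‖F i z‖ₑ := by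
      rw [← lintegral_tsum fun i => (hF i).1.enorm]
      exact lintegral_mono fun z => enorm_tsum_le_tsum_enorm
    refine h1.trans_lt ?_
    have h2 (i : ι) : ∫⁻ z, ‖F i z‖ₑ = ENNReal.ofReal (∫ z, ‖F i z‖) :=
      (ofReal_integral_norm_eq_lintegral_enorm (hF i)).symm
    simp only [h2]
    exact hsum.tsum_ofReal_lt_top

theorem hasSum_indicator_one {α : Type*} {A : Set α} (hA : A.Finite) :
    HasSum (A.indicator (1 : α → ℝ)) A.ncard := by
  have h := hasSum_sum_of_ne_finset_zero (f := A.indicator (1 : α → ℝ)) (s := hA.toFinset)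
    (L := .unconditional α) (fun b hb => indicator_of_notMem (by simpa using hb) _)
  convert h using 1
  rw [Finset.sum_congr rfl fun b hb => indicator_of_mem (hA.mem_toFinset.1 hb) _]
  simp [ncard_eq_toFinset_card A hA]

/-- The net number of jumps across a regular level, as a sum over all jumps. -/
theorem IsRegularLevel.hasSum_between {x : ℝ≥0 → ℝ} {z : ℝ} (hx : IsCadlag x)
    (hz : IsRegularLevel x z) (t : ℝ≥0) :
    HasSum (fun s : jumpTimes x t => between (Function.leftLim x s) (x s) z)
      (((jumpUpTimes x z t).ncard : ℝ) - (jumpDownTimes x z t).ncard) := by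
  have hfin := hz.finite_crossings hx t
  rw [hz.upTimes_eq, hz.downTimes_eq] at hfin
  have h := (hasSum_indicator_one (hfin.subset fun r hr => Or.inl (Or.inr hr))).sub
    (hasSum_indicator_one (A := jumpDownTimes x z t) (hfin.subset fun r hr => Or.inr (Or.inr hr)))
  have hS : Function.support (fun s => (jumpUpTimes x z t).indicator (1 : ℝ≥0 → ℝ) s -
      (jumpDownTimes x z t).indicator (1 : ℝ≥0 → ℝ) s) ⊆ jumpTimes x t := by
    intro s hs
    by_contra hsj
    have h1 : s ∉ jumpUpTimes x z t := fun h =>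
      hsj ⟨h.1, h.2.1, (sub_pos.2 (h.2.2.1.trans h.2.2.2)).ne'⟩
    have h2 : s ∉ jumpDownTimes x z t := fun h =>
      hsj ⟨h.1, h.2.1, (sub_neg.2 (h.2.2.1.trans h.2.2.2)).ne⟩
    exact hs (by simp [h1, h2])
  rw [← hasSum_subtype_iff_of_support_subset hS] at h
  convert h using 1
  funext s
  have hne : x s ≠ z ∧ Function.leftLim x s ≠ z := by
    rcases hz s with h' | h' | h'
    · exact absurd (sub_eq_zero.2 (leftLim_eq_of_continuousAt h'.2.2.1).symm) s.2.2.2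
    · exact absurd (sub_eq_zero.2 (leftLim_eq_of_continuousAt h'.2.2.1).symm) s.2.2.2
    · exact h'
  rw [between_eq_of_ne hne.2 hne.1]
  have h0 := s.2.1
  have ht := s.2.2.1
  rcases hne.1.lt_or_gt with h1 | h1 <;> rcases hne.2.lt_or_gt with h2 | h2 <;>
    simp [indicator_apply, jumpUpTimes, jumpDownTimes, h0, ht, h1, h2, h1.not_gt, h2.not_gt]

theorem IsLocallyBounded.locallyIntegrable {g : ℝ → ℝ} (hg : IsLocallyBounded g)
    (hm : Measurable g) : LocallyIntegrable g volume := by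
  refine locallyIntegrable_iff.2 fun K hK => ?_
  obtain ⟨R, hR⟩ := hK.isBounded.exists_norm_le
  obtain ⟨C, hC⟩ := hg R
  exact Measure.integrableOn_of_bounded (M := C) hK.measure_lt_top.ne hm.aestronglyMeasurable
    ((ae_restrict_mem hK.measurableSet).mono fun z hz => hC z (hR z hz))

theorem IsPrimitive.sub_eq {f g : ℝ → ℝ} (h : IsPrimitive f g)
    (hg : LocallyIntegrable g volume) (a b : ℝ) : f b - f a = ∫ z in a..b, g z := by
  obtain ⟨c, hc⟩ := h
  rw [hc, hc, add_sub_add_left_eq_sub, intervalIntegral.integral_interval_sub_left]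
  · exact (hg.integrableOn_isCompact isCompact_uIcc).intervalIntegrable
  · exact (hg.integrableOn_isCompact isCompact_uIcc).intervalIntegrable

theorem exists_abs_le {x : ℝ≥0 → ℝ} (hx : IsCadlagLFV x) (t : ℝ≥0) :
    ∃ R, ∀ s ≤ t, |x s| ≤ R ∧ |Function.leftLim x s| ≤ R := by
  obtain ⟨v, hv, hxv⟩ := exists_monotone_abs_sub_le hx.2
  have h (s : ℝ≥0) (hs : s ≤ t) : |x s| ≤ |x 0| + (v t - v 0) := by
    have h1 := hxv 0 s zero_le
    have h2 := hv hs
    have h3 := abs_sub_abs_le_abs_sub (x s) (x 0)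
    linarith
  refine ⟨|x 0| + (v t - v 0), fun s hs => ⟨h s hs, ?_⟩⟩
  rcases eq_or_ne s 0 with rfl | hs0
  · rw [leftLim_eq_of_eq_bot x (by simp)]
    exact h 0 hs
  · have hne : (𝓝[<] s).NeBot := nhdsLT_neBot_of_exists_lt ⟨0, pos_iff_ne_zero.2 hs0⟩
    refine le_of_tendsto (hx.1.tendsto_leftLim s).abs ?_
    filter_upwards [self_mem_nhdsWithin] with a ha using h a ((le_of_lt ha).trans hs)

/-- The change of variable formula. At almost every level the net number of crossings is both the
signed indicator of the interval between `x 0` and `x t` and the local time plus the sum over the jumps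
of the signed indicators of the gaps; integrating the latter sum term by term against `g` is possible
since the jumps are summable and `g` is bounded on the range of `x`. -/
theorem change_of_variable {x : ℝ≥0 → ℝ} (hx : IsCadlagLFV x) {f g : ℝ → ℝ}
    (hfg : BoundedForm f g) (t : ℝ≥0) :
    (∀ᵐ z : ℝ, up x 0 t z ≠ ⊤ ∧ down x 0 t z ≠ ⊤) ∧
      Integrable (fun z : ℝ => netCrossings x t z * g z) ∧
      (∀ᵐ z : ℝ, (incTimes x z t).Finite ∧ (decTimes x z t).Finite) ∧
      Integrable (fun z : ℝ => localTime x t z * g z) ∧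
      Summable (fun s : jumpTimes x t => f (x s) - f (Function.leftLim x s)) ∧
      f (x t) - f (x 0) = ∫ z : ℝ, netCrossings x t z * g z ∧
      ∫ z : ℝ, netCrossings x t z * g z =
        (∫ z : ℝ, localTime x t z * g z) +
          ∑' s : jumpTimes x t, (f (x s) - f (Function.leftLim x s)) := by
  obtain ⟨hgm, hgb, hprim⟩ := hfg
  have hg := hgb.locallyIntegrable hgm
  have hreg := ae_isRegularLevel hx.2
  have h0 := (countable_singleton (x 0)).ae_notMem volume
  have ht := (countable_singleton (x t)).ae_notMem volume
  have hnet : (fun z => netCrossings x t z * g z) =ᵐ[volume]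
      fun z => between (x 0) (x t) z * g z := by
    filter_upwards [hreg, h0, ht] with z hz hz0 hzt
    rw [netCrossings_eq hx.1.1 (hz.down_ne_top hx.1 t) (Ne.symm hz0) (Ne.symm hzt),
      between_eq_of_ne (Ne.symm hz0) (Ne.symm hzt)]
  have hnet_int : Integrable (fun z => netCrossings x t z * g z) :=
    (integrable_between_mul hg _ _).congr hnet.symm
  have : Countable (jumpTimes x t) := (countable_jumpTimes hx t).to_subtype
  obtain ⟨R, hR⟩ := exists_abs_le hx t
  obtain ⟨C, hC⟩ := hgb R
  let F (s : jumpTimes x t) (z : ℝ) : ℝ := between (Function.leftLim x s) (x s) z * g z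
  have hF (s : jumpTimes x t) : Integrable (F s) := integrable_between_mul hg _ _
  have hFint (s : jumpTimes x t) : ∫ z, F s z = f (x s) - f (Function.leftLim x s) := by
    rw [hprim.sub_eq hg, ← integral_between_mul hg]
  have hFsum : Summable fun s => ∫ z, ‖F s z‖ :=
    ((summable_jump hx t).mul_left C).of_nonneg_of_le
      (fun s => integral_nonneg fun z => norm_nonneg _) fun s =>
        integral_norm_between_mul_le (hR s s.2.2.1).2 (hR s s.2.2.1).1 hC
  have hFae : ∀ᵐ z, HasSum (fun s => F s z)
      ((((jumpUpTimes x z t).ncard : ℝ) - (jumpDownTimes x z t).ncard) * g z) := by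
    filter_upwards [hreg] with z hz using (hz.hasSum_between hx.1 t).mul_right (g z)
  have hS_int : Integrable fun z => ∑' s, F s z :=
    integrable_tsum_of_summable_integral_norm hF hFsum (hFae.mono fun z hz => hz.summable)
  have hloc : (fun z => localTime x t z * g z) =ᵐ[volume]
      fun z => netCrossings x t z * g z - ∑' s, F s z := by
    filter_upwards [hreg, h0, ht, hFae] with z hz hz0 hzt hzF
    rw [hzF.tsum_eq, hz.netCrossings_eq_localTime_add hx.1 (Ne.symm hz0) (Ne.symm hzt)]
    ring
  have hHS := hasSum_integral_of_summable_integral_norm hF hFsum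
  simp only [hFint] at hHS
  refine ⟨?_, hnet_int, ?_, (hnet_int.sub hS_int).congr hloc.symm, hHS.summable, ?_, ?_⟩
  · filter_upwards [hreg] with z hz
    exact ⟨up_ne_top_of_down_ne_top hx.1.1 (hz.down_ne_top hx.1 t), hz.down_ne_top hx.1 t⟩
  · filter_upwards [hreg] with z hz
    have hfin := hz.finite_crossings hx.1 t
    exact ⟨hfin.subset (incTimes_subset_upTimes.trans subset_union_left),
      hfin.subset (decTimes_subset_downTimes.trans subset_union_right)⟩
  · rw [integral_congr_ae hnet, integral_between_mul hg, hprim.sub_eq hg]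
  · rw [hHS.tsum_eq, integral_congr_ae hloc, integral_sub hnet_int hS_int, sub_add_cancel]

/-! ### The two forms of the hypothesis -/

theorem IsPrimitive.ae_hasDerivAt {f g : ℝ → ℝ} (h : IsPrimitive f g)
    (hg : LocallyIntegrable g volume) : ∀ᵐ z, HasDerivAt f (g z) z := by
  obtain ⟨c, hc⟩ := h
  filter_upwards [LocallyIntegrable.ae_hasDerivAt_integral hg] with z hz
  rw [funext hc]
  exact (hz 0).const_add c

theorem BoundedForm.lipschitzForm {f g : ℝ → ℝ} (h : BoundedForm f g) : LipschitzForm f g := by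
  obtain ⟨hgm, hgb, hprim⟩ := h
  have hg := hgb.locallyIntegrable hgm
  have h0 (y : ℝ) : f y = f 0 + ∫ z in (0 : ℝ)..y, g z := by
    rw [← hprim.sub_eq hg]; ring
  refine ⟨fun y => ?_, hgm, hg, h0, fun y => ?_⟩
  · obtain ⟨C, hC⟩ := hgb (|y| + 1)
    refine ⟨C.toNNReal, Metric.ball y 1, Metric.ball_mem_nhds y one_pos,
      LipschitzOnWith.of_dist_le_mul fun a ha b hb => ?_⟩
    rw [Real.dist_eq, Real.dist_eq, hprim.sub_eq hg, ← Real.norm_eq_abs]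
    refine intervalIntegral.norm_integral_le_of_norm_le_const fun z hz => ?_
    have hzb : z ∈ Metric.ball y 1 :=
      (convex_ball y 1).ordConnected.uIcc_subset hb ha (uIoc_subset_uIcc hz)
    rw [Metric.mem_ball, Real.dist_eq] at hzb
    refine (hC z ?_).trans (Real.le_coe_toNNReal C)
    have := abs_sub_abs_le_abs_sub z y
    linarith
  · rw [h0 y]
    congr 1
    refine intervalIntegral.integral_congr_ae ?_
    filter_upwards [hprim.ae_hasDerivAt hg] with z hz _ using hz.deriv.symm

theorem isLocallyBounded_deriv {f : ℝ → ℝ} (hf : LocallyLipschitz f) :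
    IsLocallyBounded (deriv f) := by
  intro R
  have h : ∃ C : ℝ, ∀ z ∈ Icc (-R) R, |deriv f z| ≤ C := by
    refine isCompact_Icc.induction_on (p := fun A => ∃ C : ℝ, ∀ z ∈ A, |deriv f z| ≤ C)
      ⟨0, by simp⟩ (fun A B hAB ⟨C, hC⟩ => ⟨C, fun z hz => hC z (hAB hz)⟩)
      (fun A B ⟨C, hC⟩ ⟨D, hD⟩ => ⟨max C D, fun z hz => hz.elim
        (fun h => (hC z h).trans (le_max_left _ _)) fun h => (hD z h).trans (le_max_right _ _)⟩)
      fun y _ => ?_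
    obtain ⟨K, U, hU, hK⟩ := hf y
    obtain ⟨V, hVU, hVo, hyV⟩ := mem_nhds_iff.1 hU
    refine ⟨V, mem_nhdsWithin_of_mem_nhds (hVo.mem_nhds hyV), K, fun z hz => ?_⟩
    exact norm_deriv_le_of_lipschitzOn (hVo.mem_nhds hz) (hK.mono hVU)
  obtain ⟨C, hC⟩ := h
  exact ⟨C, fun z hz => hC z (abs_le.1 hz)⟩

/-- The derivative of `f` is a locally bounded version of `g`. -/
theorem LipschitzForm.boundedForm_deriv {f g : ℝ → ℝ} (h : LipschitzForm f g) :
    BoundedForm f (deriv f) ∧ deriv f =ᵐ[volume] g := by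
  obtain ⟨hf, -, hg, hprim, hderiv⟩ := h
  refine ⟨⟨measurable_deriv f, isLocallyBounded_deriv hf, f 0, hderiv⟩, ?_⟩
  filter_upwards [IsPrimitive.ae_hasDerivAt ⟨f 0, hprim⟩ hg] with z hz using hz.deriv

/-! ### An unbounded integrand -/

/-- The path with value `a n` on `[p n, q n)` for each `n`, if these intervals are disjoint, and `0`
elsewhere. -/
noncomputable def pulses (a : ℕ → ℝ) (p q : ℕ → ℝ≥0) (s : ℝ≥0) : ℝ :=
  ∑' n, a n * (Ici (p n)).indicator 1 s - ∑' n, a n * (Ici (q n)).indicator 1 s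

theorem summable_mul_indicator {a : ℕ → ℝ} (ha : Summable a) (ha0 : ∀ n, 0 ≤ a n)
    (A : ℕ → Set ℝ≥0) (s : ℝ≥0) : Summable fun n => a n * (A n).indicator 1 s :=
  ha.of_nonneg_of_le
    (fun n => mul_nonneg (ha0 n) (indicator_nonneg (fun _ _ => zero_le_one) s))
    (fun n => mul_le_of_le_one_right (ha0 n) (indicator_le_self' (fun _ _ => zero_le_one) s))

theorem monotone_tsum_step {a : ℕ → ℝ} (ha : Summable a) (ha0 : ∀ n, 0 ≤ a n) (p : ℕ → ℝ≥0) :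
    Monotone fun s => ∑' n, a n * (Ici (p n)).indicator (1 : ℝ≥0 → ℝ) s := by
  intro s s' hs
  refine (summable_mul_indicator ha ha0 _ s).tsum_le_tsum (fun n => ?_)
    (summable_mul_indicator ha ha0 _ s')
  refine mul_le_mul_of_nonneg_left ?_ (ha0 n)
  by_cases h : p n ≤ s
  · simp [h, h.trans hs]
  · rw [indicator_of_notMem (show s ∉ Ici (p n) from h)]
    exact indicator_nonneg (fun _ _ => zero_le_one) s'

theorem tendsto_tsum_step_right {a : ℕ → ℝ} (ha : Summable a) (ha0 : ∀ n, 0 ≤ a n)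
    (p : ℕ → ℝ≥0) (r : ℝ≥0) :
    Tendsto (fun s => ∑' n, a n * (Ici (p n)).indicator (1 : ℝ≥0 → ℝ) s) (𝓝[≥] r)
      (𝓝 (∑' n, a n * (Ici (p n)).indicator 1 r)) := by
  refine tendsto_tsum_of_dominated_convergence ha (fun n => ?_) ?_
  · refine tendsto_const_nhds.congr' ?_
    by_cases h : p n ≤ r
    · filter_upwards [self_mem_nhdsWithin] with s hs
      have : p n ≤ s := h.trans hs
      simp [h, this]
    · filter_upwards [nhdsWithin_le_nhds (Iio_mem_nhds (not_le.1 h))] with s hs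
      simp [h, not_le.2 (show s < p n from hs)]
  · refine Eventually.of_forall fun s n => ?_
    rw [Real.norm_of_nonneg
      (mul_nonneg (ha0 n) (indicator_nonneg (f := 1) (fun _ _ => zero_le_one) s))]
    exact mul_le_of_le_one_right (ha0 n) (indicator_le_self' (fun _ _ => zero_le_one) s)

theorem tendsto_tsum_step_left {a : ℕ → ℝ} (ha : Summable a) (ha0 : ∀ n, 0 ≤ a n)
    (p : ℕ → ℝ≥0) (r : ℝ≥0) :
    Tendsto (fun s => ∑' n, a n * (Ici (p n)).indicator (1 : ℝ≥0 → ℝ) s) (𝓝[<] r)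
      (𝓝 (∑' n, a n * (Ioi (p n)).indicator 1 r)) := by
  refine tendsto_tsum_of_dominated_convergence ha (fun n => ?_) ?_
  · refine tendsto_const_nhds.congr' ?_
    by_cases h : p n < r
    · filter_upwards [nhdsWithin_le_nhds (Ioi_mem_nhds h)] with s hs
      simp [h, le_of_lt (show p n < s from hs)]
    · filter_upwards [self_mem_nhdsWithin] with s hs
      have : ¬ p n ≤ s := not_le.2 (lt_of_lt_of_le hs (not_lt.1 h))
      simp [h, this]
  · refine Eventually.of_forall fun s n => ?_
    rw [Real.norm_of_nonneg
      (mul_nonneg (ha0 n) (indicator_nonneg (f := 1) (fun _ _ => zero_le_one) s))]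
    exact mul_le_of_le_one_right (ha0 n) (indicator_le_self' (fun _ _ => zero_le_one) s)

/-- The increments of `F - G` are dominated by those of the monotone function `F + G`. -/
theorem locallyBoundedVariationOn_sub_of_monotone {F G : ℝ≥0 → ℝ} (hF : Monotone F)
    (hG : Monotone G) : LocallyBoundedVariationOn (fun s => F s - G s) univ := by
  intro a b ha hb
  refine ne_top_of_le_ne_top (((hF.add hG).monotoneOn univ).locallyBoundedVariationOn a b ha hb)
    (iSup_mono fun u => Finset.sum_le_sum fun i _ => ?_)
  have hu : u.2.1 i ≤ u.2.1 (i + 1) := u.2.2.1 (Nat.le_succ i)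
  have h1 := hF hu
  have h2 := hG hu
  simp only [edist_dist, Real.dist_eq]
  refine ENNReal.ofReal_le_ofReal (abs_le_abs ?_ ?_) <;> linarith

theorem isCadlagLFV_pulses {a : ℕ → ℝ} (ha : Summable a) (ha0 : ∀ n, 0 ≤ a n)
    (p q : ℕ → ℝ≥0) : IsCadlagLFV (pulses a p q) := by
  refine ⟨⟨fun r => ?_, fun r _ => ?_⟩, ?_⟩
  · exact (tendsto_tsum_step_right ha ha0 p r).sub (tendsto_tsum_step_right ha ha0 q r)
  · exact ⟨_, (tendsto_tsum_step_left ha ha0 p r).sub (tendsto_tsum_step_left ha ha0 q r)⟩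
  · exact locallyBoundedVariationOn_sub_of_monotone (monotone_tsum_step ha ha0 p)
      (monotone_tsum_step ha ha0 q)

theorem pulses_apply {a : ℕ → ℝ} (ha : Summable a) (ha0 : ∀ n, 0 ≤ a n) {p q : ℕ → ℝ≥0}
    (hpq : ∀ n, p n < q n) (hqp : ∀ m n, m < n → q n ≤ p m) (n : ℕ) :
    pulses a p q (p n) = a n := by
  rw [pulses, ← (summable_mul_indicator ha ha0 _ _).tsum_sub (summable_mul_indicator ha ha0 _ _),
    tsum_eq_single n]
  · simp [(hpq n).not_ge]
  · intro m hm
    rcases hm.lt_or_gt with h | h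
    · have h1 : p n < p m := (hpq n).trans_le (hqp m n h)
      simp [h1.not_ge, (h1.trans (hpq m)).not_ge]
    · have h1 : q m ≤ p n := hqp n m h
      simp [h1, (hpq m).le.trans h1]

theorem leftLim_pulses {a : ℕ → ℝ} (ha : Summable a) (ha0 : ∀ n, 0 ≤ a n) {p q : ℕ → ℝ≥0}
    (hp : ∀ n, 0 < p n) (hpq : ∀ n, p n < q n) (hqp : ∀ m n, m < n → q n < p m) (n : ℕ) :
    Function.leftLim (pulses a p q) (p n) = 0 := by
  have hne : (𝓝[<] p n).NeBot := nhdsLT_neBot_of_exists_lt ⟨0, hp n⟩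
  rw [leftLim_eq_of_tendsto (f := pulses a p q)
    ((tendsto_tsum_step_left ha ha0 p (p n)).sub (tendsto_tsum_step_left ha ha0 q (p n))),
    ← (summable_mul_indicator ha ha0 _ _).tsum_sub (summable_mul_indicator ha ha0 _ _)]
  refine (tsum_congr fun m => ?_).trans tsum_zero
  rcases lt_trichotomy m n with h | rfl | h
  · have h1 : p n < p m := (hpq n).trans (hqp m n h)
    simp [h1.not_gt, (h1.trans (hpq m)).not_gt]
  · simp [(hpq m).not_gt]
  · have h1 : q m < p n := hqp n m h
    simp [h1, (hpq m).trans h1]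

/-- The counterexample: `f y = 2 √y`, and a path with a pulse of height `1 / (n + 1)²` for each `n`. The
heights are summable, but `f` jumps by `2 / (n + 1)` at the start of the `n`-th pulse. The pulses
accumulate at time `0` from the right. -/
theorem exists_not_summable :
    ∃ (x : ℝ≥0 → ℝ) (f g : ℝ → ℝ) (t : ℝ≥0), IsCadlagLFV x ∧
      Measurable g ∧ LocallyIntegrable g volume ∧ IsPrimitive f g ∧
      ¬ Summable (fun s : jumpTimes x t => f (x s) - f (Function.leftLim x s)) := by
  set a : ℕ → ℝ := fun n => 1 / ((n : ℝ) + 1) ^ 2 with ha_def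
  set p : ℕ → ℝ≥0 := fun n => 1 / (2 * n + 2) with hp_def
  set q : ℕ → ℝ≥0 := fun n => 1 / (2 * n + 1) with hq_def
  have ha : Summable a := by
    refine ((summable_nat_add_iff 1).2 (Real.summable_one_div_nat_pow.2 one_lt_two)).congr
      fun n => ?_
    simp [ha_def]
  have hapos (n : ℕ) : 0 < a n := by positivity
  have hp (n : ℕ) : 0 < p n := by positivity
  have hpq (n : ℕ) : p n < q n := by
    refine one_div_lt_one_div_of_lt (by positivity) ?_
    gcongr
    exact one_lt_two
  have hqp (m n : ℕ) (h : m < n) : q n < p m := by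
    refine one_div_lt_one_div_of_lt (by positivity) ?_
    exact_mod_cast (by omega : 2 * m + 2 < 2 * n + 1)
  have hx1 := pulses_apply ha (fun n => (hapos n).le) hpq fun m n h => (hqp m n h).le
  have hx2 := leftLim_pulses ha (fun n => (hapos n).le) hp hpq hqp
  set x := pulses a p q
  set g : ℝ → ℝ := fun z => z ^ (-(1 / 2) : ℝ) with hg_def
  have hgi (b c : ℝ) : IntervalIntegrable g volume b c :=
    intervalIntegral.intervalIntegrable_rpow' (by norm_num)
  refine ⟨x, fun y => ∫ z in (0 : ℝ)..y, g z, g, 1, isCadlagLFV_pulses ha (fun n => (hapos n).le) p q,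
    by fun_prop, ?_, ⟨0, fun y => (zero_add _).symm⟩, fun hsum => ?_⟩
  · refine locallyIntegrable_iff.2 fun K hK => ?_
    obtain ⟨R, hR⟩ := hK.isBounded.exists_norm_le
    rcases K.eq_empty_or_nonempty with rfl | ⟨y, hy⟩
    · simp
    · have hR0 : -R ≤ R := by linarith [(norm_nonneg y).trans (hR y hy)]
      exact ((intervalIntegrable_iff_integrableOn_Icc_of_le hR0).1 (hgi _ _)).mono_set
        fun z hz => abs_le.1 (hR z hz)
  · have hmem (n : ℕ) : p n ∈ jumpTimes x 1 := by
      refine ⟨hp n, ?_, ?_⟩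
      · refine (one_div_le (by positivity) one_pos).2 ?_
        rw [one_div_one]
        exact_mod_cast (by omega : 1 ≤ 2 * n + 2)
      · rw [jump, hx1, hx2, sub_zero]
        exact (hapos n).ne'
    have hinj : Function.Injective fun n => (⟨p n, hmem n⟩ : jumpTimes x 1) := by
      intro m n hmn
      have hmn : p m = p n := congrArg Subtype.val hmn
      by_contra hne
      rcases lt_or_gt_of_ne hne with h | h
      · exact ((hpq n).trans (hqp m n h)).ne hmn.symm
      · exact ((hpq m).trans (hqp n m h)).ne hmn
    have h := hsum.comp_injective hinj
    have hterm (n : ℕ) : ∫ z in (0 : ℝ)..a n, g z = 2 * (1 / ((n + 1 : ℕ) : ℝ)) := by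
      rw [hg_def, integral_rpow (Or.inl (by norm_num))]
      have h1 : (-(1 / 2) + 1 : ℝ) = 1 / 2 := by norm_num
      rw [h1, ← Real.sqrt_eq_rpow, ← Real.sqrt_eq_rpow, Real.sqrt_zero, ha_def]
      simp only
      rw [Real.sqrt_div zero_le_one, Real.sqrt_one, Real.sqrt_sq (by positivity)]
      push_cast
      ring
    have h2 : Summable fun n : ℕ => 2 * (1 / ((n + 1 : ℕ) : ℝ)) := by
      refine h.congr fun n => ?_
      simp only [Function.comp_apply, hx1, hx2, hterm, intervalIntegral.integral_same, sub_zero]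
    rw [summable_mul_left_iff two_ne_zero] at h2
    exact Real.not_summable_one_div_natCast ((summable_nat_add_iff 1).1 h2)

end LevelCrossing

theorem proposition2 :
    -- the two forms of the hypothesis on `f` and `g` are equivalent, up to null sets for `g`
    (∀ f g : ℝ → ℝ, LevelCrossing.BoundedForm f g → LevelCrossing.LipschitzForm f g) ∧
    (∀ f g : ℝ → ℝ, LevelCrossing.LipschitzForm f g →
      ∃ h : ℝ → ℝ, LevelCrossing.BoundedForm f h ∧ h =ᵐ[volume] g) ∧
    -- the change of variable formula, with all its terms well defined
    (∀ (x : ℝ≥0 → ℝ) (f g : ℝ → ℝ) (t : ℝ≥0), LevelCrossing.IsCadlagLFV x →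
      (LevelCrossing.BoundedForm f g ∨ LevelCrossing.LipschitzForm f g) →
      (∀ᵐ z : ℝ, LevelCrossing.up x 0 t z ≠ ⊤ ∧ LevelCrossing.down x 0 t z ≠ ⊤) ∧
      Integrable (fun z : ℝ => LevelCrossing.netCrossings x t z * g z) ∧
      (∀ᵐ z : ℝ, (LevelCrossing.incTimes x z t).Finite ∧
        (LevelCrossing.decTimes x z t).Finite) ∧
      Integrable (fun z : ℝ => LevelCrossing.localTime x t z * g z) ∧
      Summable (fun s : LevelCrossing.jumpTimes x t => f (x s) - f (Function.leftLim x s)) ∧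
      f (x t) - f (x 0) = ∫ z : ℝ, LevelCrossing.netCrossings x t z * g z ∧
      ∫ z : ℝ, LevelCrossing.netCrossings x t z * g z =
        (∫ z : ℝ, LevelCrossing.localTime x t z * g z) +
          ∑' s : LevelCrossing.jumpTimes x t, (f (x s) - f (Function.leftLim x s))) ∧
    -- local boundedness of `g` cannot be weakened to local integrability
    (∃ (x : ℝ≥0 → ℝ) (f g : ℝ → ℝ) (t : ℝ≥0), LevelCrossing.IsCadlagLFV x ∧
      Measurable g ∧ LocallyIntegrable g volume ∧ LevelCrossing.IsPrimitive f g ∧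
      ¬ Summable (fun s : LevelCrossing.jumpTimes x t =>
        f (x s) - f (Function.leftLim x s))) := by
  refine ⟨fun f g h => h.lipschitzForm, fun f g h => ⟨deriv f, h.boundedForm_deriv⟩,
    fun x f g t hx hfg => ?_, LevelCrossing.exists_not_summable⟩
  rcases hfg with hfg | hfg
  · exact LevelCrossing.change_of_variable hx hfg t
  · obtain ⟨hb, hae⟩ := hfg.boundedForm_deriv
    obtain ⟨h1, h2, h3, h4, h5, h6, h7⟩ := LevelCrossing.change_of_variable hx hb t
    have e1 : (fun z => LevelCrossing.netCrossings x t z * deriv f z) =ᵐ[volume]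
        fun z => LevelCrossing.netCrossings x t z * g z :=
      hae.mono fun z hz => congrArg (LevelCrossing.netCrossings x t z * ·) hz
    have e2 : (fun z => LevelCrossing.localTime x t z * deriv f z) =ᵐ[volume]
        fun z => LevelCrossing.localTime x t z * g z :=
      hae.mono fun z hz => congrArg (LevelCrossing.localTime x t z * ·) hz
    rw [integral_congr_ae e1] at h6
    rw [integral_congr_ae e1, integral_congr_ae e2] at h7
    exact ⟨h1, h2.congr e1, h3, h4.congr e2, h5, h6, h7⟩
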